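/- Let $\kappa>0$ and $1<p<\infty$, and consider the one-dimensional equation $$(p-1)|w'|^{p-2}w''-\kappa\,t\,|w'|^{p-2}w'=-\lambda|w|^{p-2}w, \qquad (1)$$ where solutions are understood with $w$ and $|w'|^{p-2}w'$ of class $C^1$ and $(p-1)|w'|^{p-2}w''$ denotes $(|w'|^{p-2}w')'$. For an open interval $I\subseteq\mathbb R$ let $$\Lambda(I)=\inf\left\{\frac{\int_I|\varphi'|^pe^{-\kappa s^2/2}\,ds}{\int_I|\varphi|^pe^{-\kappa s^2/2}\,ds}:\ \varphi\in W^{1,p}(I,e^{-\kappa s^2/2}ds)\setminus\{0\},\ \int_I|\varphi|^{p-2}\varphi\, e^{-\kappa s^2/2}\,ds=0\right\},$$ and let $\lambda_0=\Lambda(\mathbb R)$. Then: (i) For every $\lambda>\lambda_0$ there is a unique $\bar a=\bar a(\lambda)>0$ for which there is an odd solution $w$ of (1) on $\mathbb R$ with $w(-\bar a)=-1$ and $w'(-\bar a)=0$ such that $\bar a$ is the first zero of $w'$ in $(-\bar a,\infty)$. (ii) The function $\bar\delta(\lambda)=2\bar a(\lambda)$ is a strictly decreasing bijection from $(\lambda_0,\infty)$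 onto $(0,\infty)$, and its inverse $\delta\mapsto\lambda(\delta)$ is continuous and strictly decreasing on $(0,\infty)$. (iii) For every $\delta>0$, $\lambda(\delta)$ is the first nonzero Neumann eigenvalue of (1) on $[-\delta/2,\delta/2]$: it is the smallest nonzero real $\mu$ for which (1) with $\lambda=\mu$ has a solution on $[-\delta/2,\delta/2]$ that is not identically zero and satisfies $w'(-\delta/2)=w'(\delta/2)=0$. Moreover $\lambda(\delta)=\Lambda((-\delta/2,\delta/2))$, and this infimum is attained. -/

import Mathlib

open Set MeasureTheory
open scoped ContDiff

namespace PModel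

noncomputable section

/-- The odd power map `s ↦ |s|^(p-2) s`; it is `0` at `s = 0`. -/
def oddPow (p s : ℝ) : ℝ := |s| ^ (p - 2) * s

/-- `w` solves `(p-1)|w'|^(p-2) w'' - κ t |w'|^(p-2) w' = -lam |w|^(p-2) w` on `s`
(the whole line or a compact interval), where, as usual, `w` and the flux
`|w'|^(p-2) w'` are `C¹` and `(p-1)|w'|^(p-2) w''` stands for the derivative of the flux. -/
structure IsSolutionOn (p κ lam : ℝ) (s : Set ℝ) (w : ℝ → ℝ) : Prop where
  contDiffOn : ContDiffOn ℝ 1 w s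
  contDiffOn_flux : ContDiffOn ℝ 1 (fun t => oddPow p (derivWithin w s t)) s
  equation : ∀ t ∈ s,
    derivWithin (fun x => oddPow p (derivWithin w s x)) s t
      - κ * t * oddPow p (derivWithin w s t) = -lam * oddPow p (w t)

/-- `w = w_a`: the solution on the line with `w(a) = -1` and `w'(a) = 0`. -/
def IsCauchySolution (p κ lam a : ℝ) (w : ℝ → ℝ) : Prop :=
  IsSolutionOn p κ lam univ w ∧ w a = -1 ∧ deriv w a = 0

/-- `a > 0`, the solution `w = w_{-a}` is odd, and the first zero of `w'` to the right of `-a`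
is `a`, so that `w` increases from `-1` to `1` on `[-a, a]`, an interval of length `2 a`. -/
def IsCentral (p κ lam a : ℝ) : Prop :=
  0 < a ∧ ∃ w : ℝ → ℝ, IsCauchySolution p κ lam (-a) w ∧ Function.Odd w ∧
    IsLeast {b : ℝ | -a < b ∧ deriv w b = 0} a

/-- The number `ā(lam)` (the set has exactly one element for `lam > lambdaZero p κ`). -/
def aBar (p κ lam : ℝ) : ℝ := sInf {a : ℝ | IsCentral p κ lam a}

/-- `δ̄(lam) = 2 ā(lam)`. -/
def deltaBar (p κ lam : ℝ) : ℝ := 2 * aBar p κ lam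

/-- The measure `exp(-κ t²/2) dt` on `s`. -/
def weight (κ : ℝ) (s : Set ℝ) : Measure ℝ :=
  (volume.restrict s).withDensity (fun t => ENNReal.ofReal (Real.exp (-(κ / 2) * t ^ 2)))

/-- `φ ∈ W^{1,p}(s, exp(-κ t²/2) dt)` with weak derivative `g`, for an open set `s`. -/
structure IsSobolev (p κ : ℝ) (s : Set ℝ) (φ g : ℝ → ℝ) : Prop where
  memLp : MemLp φ (ENNReal.ofReal p) (weight κ s)
  memLp_deriv : MemLp g (ENNReal.ofReal p) (weight κ s)
  weak_deriv : ∀ ψ : ℝ → ℝ, ContDiff ℝ ∞ ψ → HasCompactSupport ψ → tsupport ψ ⊆ s →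
    ∫ t in s, φ t * deriv ψ t = -∫ t in s, g t * ψ t

/-- The values of the Rayleigh quotient `∫|φ'|^p / ∫|φ|^p` (integrals against `weight κ s`) over
the nonzero `φ ∈ W^{1,p}` with `∫ |φ|^(p-2) φ = 0`. -/
def rayleighValues (p κ : ℝ) (s : Set ℝ) : Set ℝ :=
  {R : ℝ | ∃ φ g : ℝ → ℝ, IsSobolev p κ s φ g ∧ ¬ (φ =ᵐ[weight κ s] 0) ∧
    ∫ t, oddPow p (φ t) ∂(weight κ s) = 0 ∧
    R = (∫ t, |g t| ^ p ∂(weight κ s)) / (∫ t, |φ t| ^ p ∂(weight κ s))}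

/-- The first nonzero eigenvalue of the problem on the whole line. -/
def lambdaZero (p κ : ℝ) : ℝ := sInf (rayleighValues p κ univ)

/-- The inverse `δ ↦ lam(δ)` of `deltaBar p κ : (lambdaZero p κ, ∞) → (0, ∞)`. -/
def lambdaOf (p κ : ℝ) : ℝ → ℝ := Function.invFunOn (deltaBar p κ) (Ioi (lambdaZero p κ))

/-- `μ` is a Neumann eigenvalue on `[-δ/2, δ/2]`: there is a solution which is not identically
zero on the interval and has vanishing derivative at both end points. -/
def IsNeumannEigenvalue (p κ δ μ : ℝ) : Prop :=
  ∃ w : ℝ → ℝ, IsSolutionOn p κ μ (Icc (-(δ / 2)) (δ / 2)) w ∧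
    (∃ t ∈ Icc (-(δ / 2)) (δ / 2), w t ≠ 0) ∧
    derivWithin w (Icc (-(δ / 2)) (δ / 2)) (-(δ / 2)) = 0 ∧
    derivWithin w (Icc (-(δ / 2)) (δ / 2)) (δ / 2) = 0

end

end PModel

namespace PModel

/-! Everything is governed by the one-sided weighted Hardy inequality `HalfIneq`, `L ∫_J (∫₀ᵗ g)^p ρ
≤ ∫_J g^p ρ` for `g ≥ 0`, on `J = (0, a)` or `J = (0, ∞)`.

An odd solution `w` with `w' > 0` on `(0, a)` and `w'(a) = 0` makes `lam` the best constant on `(0,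
a)` (`IsCentral.isGreatest_halfIneq`). That `lam` is admissible comes from Hölder with weight `w'`,
Tonelli, and the integrated equation `lam ∫_s^a w^(p-1) ρ = ρ(s) w'(s)^(p-1)`; that nothing larger
is admissible comes from `g = w'`, for which equality holds. The best constant strictly increases
when the interval shrinks (`HalfIneq.exists_lt`), because extending `g` by zero leaves a positive
contribution of its primitive on the removed piece. Uniqueness of `a` and monotonicity of `δ̄`
follow from this alone, with no uniqueness theorem for the differential equation.

On an interval symmetric about `0`, the Hardy inequality bounds the Rayleigh quotient from below:
the constraint says that `φ` has the smallest `L^p` norm among its translates `φ - C`, so `φ` may be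
replaced by `φ - φ(0)` and the two halves treated separately (`HalfIneq.le_of_mem_rayleighValues`).
Conversely, odd extensions satisfy the constraint, so `λ₀` is an admissible constant on every `(0,
b)` (`halfIneq_lambdaZero`).

A global odd solution exists for every `lam` (`exists_odd_flow`). If `lam > λ₀`, its derivative must
vanish somewhere: otherwise `lam` would be admissible on `(0, ∞)`, forcing `lam ≤ λ₀`. Given `a`,
the best constant on `(0, a)` exceeds `λ₀`, and strict monotonicity identifies `a` with the
half-length of its central solution; this is surjectivity. Finally, an eigenfunction with nonzero
eigenvalue is a competitor whose quotient is that eigenvalue, so one lower bound settles both the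
smallest eigenvalue and the attained infimum. -/

/-! ### The odd power map and its inverse -/

theorem oddPow_of_nonneg {p s : ℝ} (hp : 1 < p) (hs : 0 ≤ s) : oddPow p s = s ^ (p - 1) := by
  rcases hs.eq_or_lt with rfl | hs
  · simp [oddPow, Real.zero_rpow (by linarith : p - 1 ≠ 0)]
  · rw [oddPow, abs_of_pos hs, show p - 1 = (p - 2) + 1 by ring, Real.rpow_add_one hs.ne']

theorem oddPow_neg (p s : ℝ) : oddPow p (-s) = -oddPow p s := by
  simp [oddPow]

@[simp] theorem oddPow_zero (p : ℝ) : oddPow p 0 = 0 := by simp [oddPow]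

theorem oddPow_mul (p x y : ℝ) : oddPow p (x * y) = oddPow p x * oddPow p y := by
  simp only [oddPow, abs_mul, Real.mul_rpow (abs_nonneg x) (abs_nonneg y)]; ring

theorem abs_oddPow {p : ℝ} (hp : 1 < p) (s : ℝ) : |oddPow p s| = |s| ^ (p - 1) := by
  rw [← oddPow_of_nonneg hp (abs_nonneg s), oddPow, oddPow, abs_mul, abs_abs,
    abs_of_nonneg (Real.rpow_nonneg (abs_nonneg s) _)]

theorem oddPow_mul_self {p : ℝ} (hp : 1 < p) (s : ℝ) : oddPow p s * s = |s| ^ p := by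
  rcases eq_or_ne s 0 with rfl | hs
  · simp [Real.zero_rpow (by linarith : p ≠ 0)]
  · rw [oddPow, mul_assoc, ← sq, ← sq_abs, ← Real.rpow_natCast, ← Real.rpow_add (abs_pos.2 hs)]
    norm_num

theorem oddPow_pos {p s : ℝ} (hs : 0 < s) : 0 < oddPow p s :=
  mul_pos (Real.rpow_pos_of_pos (abs_pos.2 hs.ne') _) hs

theorem oddPow_eq_zero {p s : ℝ} : oddPow p s = 0 ↔ s = 0 := by
  constructor
  · intro h
    rcases mul_eq_zero.1 h with h | h
    · exact abs_eq_zero.1 ((Real.rpow_eq_zero_iff_of_nonneg (abs_nonneg s)).1 h).1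
    · exact h
  · rintro rfl; simp

theorem hasDerivAt_abs_rpow_oddPow {p : ℝ} (hp : 1 < p) (x : ℝ) :
    HasDerivAt (fun x : ℝ => |x| ^ p) (p * oddPow p x) x := by
  simpa [oddPow, mul_assoc] using hasDerivAt_abs_rpow x hp

theorem continuous_oddPow {p : ℝ} (hp : 1 < p) : Continuous (oddPow p) := by
  have h : oddPow p = fun s => (SignType.sign s : ℝ) * |s| ^ (p - 1) := by
    ext s
    rcases lt_trichotomy s 0 with hs | rfl | hs
    · rw [← neg_neg s, oddPow_neg, oddPow_of_nonneg hp (by linarith), abs_neg,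
        abs_of_pos (by linarith : 0 < -s)]
      simp [sign_neg hs]
    · simp
    · rw [oddPow_of_nonneg hp hs.le, abs_of_pos hs]
      simp [sign_pos hs]
  rw [continuous_iff_continuousAt]
  intro s
  rcases eq_or_ne s 0 with rfl | hs
  · rw [ContinuousAt, oddPow_zero]
    apply squeeze_zero_norm (a := fun s : ℝ => |s| ^ (p - 1))
    · intro s; rw [Real.norm_eq_abs, abs_oddPow hp]
    · have : Continuous fun s : ℝ => |s| ^ (p - 1) :=
        continuous_abs.rpow_const fun x => Or.inr (by linarith)
      have h0 := this.tendsto 0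
      rwa [abs_zero, Real.zero_rpow (by linarith : p - 1 ≠ 0)] at h0
  · unfold oddPow
    exact (continuous_abs.continuousAt.rpow_const (Or.inl (abs_ne_zero.2 hs))).mul continuousAt_id

theorem hasDerivAt_oddPow {p s : ℝ} (hs : s ≠ 0) :
    HasDerivAt (oddPow p) ((p - 1) * |s| ^ (p - 2)) s := by
  have key : ∀ s : ℝ, 0 < s → HasDerivAt (oddPow p) ((p - 1) * |s| ^ (p - 2)) s := by
    intro s hs
    have h1 : HasDerivAt (fun x : ℝ => x ^ (p - 1)) ((p - 1) * s ^ (p - 1 - 1)) s :=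
      Real.hasDerivAt_rpow_const (Or.inl hs.ne')
    rw [abs_of_pos hs, show p - 2 = p - 1 - 1 by ring]
    refine h1.congr_of_eventuallyEq ?_
    filter_upwards [lt_mem_nhds hs] with x hx
    rw [oddPow, abs_of_pos hx, show p - 1 = (p - 2) + 1 by ring, Real.rpow_add_one hx.ne']
  rcases lt_or_gt_of_ne hs with hs | hs
  · have h1 := (key (-s) (by linarith)).comp s (hasDerivAt_neg s)
    have h2 : oddPow p = -(oddPow p ∘ Neg.neg) := by
      ext s; simp [oddPow_neg]
    rw [h2]
    exact h1.neg.congr_deriv (by simp)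
  · exact key s hs

/-- The exponent conjugate to `p`. -/
noncomputable def conjExp (p : ℝ) : ℝ := p / (p - 1)

theorem one_lt_conjExp {p : ℝ} (hp : 1 < p) : 1 < conjExp p := by
  rw [conjExp, lt_div_iff₀ (by linarith)]; linarith

theorem conjExp_sub_one {p : ℝ} (hp : 1 < p) : conjExp p - 1 = (p - 1)⁻¹ := by
  have : p - 1 ≠ 0 := by linarith
  rw [conjExp]; field_simp; ring

theorem conjExp_conjExp {p : ℝ} (hp : 1 < p) : conjExp (conjExp p) = p := by
  have : p - 1 ≠ 0 := by linarith
  rw [conjExp, conjExp_sub_one hp, conjExp]; field_simp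

theorem oddPow_conjExp_oddPow {p : ℝ} (hp : 1 < p) (s : ℝ) :
    oddPow (conjExp p) (oddPow p s) = s := by
  have key : ∀ s : ℝ, 0 ≤ s → oddPow (conjExp p) (oddPow p s) = s := by
    intro s hs
    rw [oddPow_of_nonneg hp hs, oddPow_of_nonneg (one_lt_conjExp hp) (Real.rpow_nonneg hs _),
      conjExp_sub_one hp, Real.rpow_rpow_inv hs (by linarith)]
  rcases le_total 0 s with hs | hs
  · exact key s hs
  · have := key (-s) (by linarith)
    rw [oddPow_neg, oddPow_neg] at this
    linarith

theorem oddPow_oddPow_conjExp {p : ℝ} (hp : 1 < p) (s : ℝ) :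
    oddPow p (oddPow (conjExp p) s) = s := by
  have := oddPow_conjExp_oddPow (one_lt_conjExp hp) s
  rwa [conjExp_conjExp hp] at this

/-! ### The Gaussian weight -/

/-- The density `exp(-κ t²/2)`. -/
noncomputable def rho (κ t : ℝ) : ℝ := Real.exp (-(κ / 2) * t ^ 2)

theorem rho_pos (κ t : ℝ) : 0 < rho κ t := Real.exp_pos _

theorem rho_neg (κ t : ℝ) : rho κ (-t) = rho κ t := by simp [rho]

theorem rho_le_one {κ : ℝ} (hκ : 0 < κ) (t : ℝ) : rho κ t ≤ 1 := by
  rw [rho, Real.exp_le_one_iff]; nlinarith [sq_nonneg t]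

theorem continuous_rho (κ : ℝ) : Continuous (rho κ) := by unfold rho; fun_prop

theorem hasDerivAt_rho (κ t : ℝ) : HasDerivAt (rho κ) (-(κ * t) * rho κ t) t := by
  have h : HasDerivAt (fun t : ℝ => -(κ / 2) * t ^ 2) (-(κ * t)) t := by
    exact ((hasDerivAt_pow 2 t).const_mul (-(κ / 2))).congr_deriv (by norm_num; ring)
  exact h.exp.congr_deriv (by rw [rho]; ring)

theorem integrable_rho {κ : ℝ} (hκ : 0 < κ) : Integrable (rho κ) :=
  integrable_exp_neg_mul_sq (by linarith : 0 < κ / 2)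

theorem measurable_ofReal_rho (κ : ℝ) : Measurable fun t => ENNReal.ofReal (rho κ t) :=
  (continuous_rho κ).measurable.ennreal_ofReal

theorem weight_eq (κ : ℝ) (s : Set ℝ) :
    weight κ s = (volume.restrict s).withDensity fun t => ENNReal.ofReal (rho κ t) := rfl

theorem lintegral_weight (κ : ℝ) (s : Set ℝ) (f : ℝ → ENNReal) :
    ∫⁻ t, f t ∂(weight κ s) = ∫⁻ t in s, f t * ENNReal.ofReal (rho κ t) := by
  rw [weight_eq, lintegral_withDensity_eq_lintegral_mul_non_measurable _
    (measurable_ofReal_rho κ) (by simp)]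
  simp [mul_comm]

theorem integral_weight (κ : ℝ) (s : Set ℝ) (f : ℝ → ℝ) :
    ∫ t, f t ∂(weight κ s) = ∫ t in s, f t * rho κ t := by
  rw [weight_eq, integral_withDensity_eq_integral_toReal_smul (measurable_ofReal_rho κ) (by simp)]
  simp [ENNReal.toReal_ofReal (rho_pos κ _).le, mul_comm]

theorem isFiniteMeasure_weight {κ : ℝ} (hκ : 0 < κ) (s : Set ℝ) :
    IsFiniteMeasure (weight κ s) := by
  rw [weight_eq]
  exact isFiniteMeasure_withDensity_ofReal (integrable_rho hκ).integrableOn.2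

theorem restrict_absolutelyContinuous_weight (κ : ℝ) (s : Set ℝ) :
    volume.restrict s ≪ weight κ s := by
  rw [weight_eq]
  refine withDensity_absolutelyContinuous' (measurable_ofReal_rho κ).aemeasurable ?_
  filter_upwards with t
  simp [rho_pos]

theorem weight_absolutelyContinuous (κ : ℝ) (s : Set ℝ) :
    weight κ s ≪ volume.restrict s := by
  rw [weight_eq]; exact withDensity_absolutelyContinuous _ _

theorem integrable_weight_iff (κ : ℝ) (s : Set ℝ) (f : ℝ → ℝ) :
    Integrable f (weight κ s) ↔ IntegrableOn (fun t => f t * rho κ t) s := by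
  rw [weight_eq, integrable_withDensity_iff (measurable_ofReal_rho κ) (by simp)]
  simp [IntegrableOn, ENNReal.toReal_ofReal (rho_pos κ _).le]

/-! ### The one-sided Hardy inequality -/

/-- The weighted one-sided Poincaré inequality `L ∫_J |φ|^p ρ ≤ ∫_J |φ'|^p ρ` for `φ(0) = 0`, where
`J = (0, a)` or `J = (0, ∞)`, stated in terms of `g = |φ'|`. -/
def HalfIneq (p κ L : ℝ) (J : Set ℝ) : Prop :=
  ∀ g : ℝ → ENNReal, Measurable g →
    ENNReal.ofReal L * ∫⁻ t in J, (∫⁻ s in Ioo 0 t, g s) ^ p * ENNReal.ofReal (rho κ t)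
      ≤ ∫⁻ t in J, g t ^ p * ENNReal.ofReal (rho κ t)

/-- Hölder applied to `g = (g H^(-1/q)) · H^(1/q)`. The weight `H` is free, and the sharp choice is
the derivative of a solution. -/
theorem rpow_lintegral_le_mul_rpow {p : ℝ} (hp : 1 < p) {μ : Measure ℝ} {g H : ℝ → ENNReal}
    (hg : Measurable g) (hH : Measurable H) (h0 : ∀ᵐ s ∂μ, H s ≠ 0) (hT : ∀ᵐ s ∂μ, H s ≠ ⊤) :
    (∫⁻ s, g s ∂μ) ^ p ≤ (∫⁻ s, g s ^ p * H s ^ (-(p - 1)) ∂μ) * (∫⁻ s, H s ∂μ) ^ (p - 1) := by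
  have hp0 : 0 < p := by linarith
  have hp1 : 0 < p - 1 := by linarith
  have hpq : p.HolderConjugate (p / (p - 1)) := Real.HolderConjugate.conjExponent hp
  set q := p / (p - 1) with hq
  have hq0 : 0 < q := by positivity
  have e1 : ∫⁻ s, g s ∂μ = ∫⁻ s, ((fun s => g s * H s ^ (-(1 / q))) * fun s => H s ^ (1 / q)) s ∂μ := by
    refine lintegral_congr_ae ?_
    filter_upwards [h0, hT] with s h0 hT
    rw [Pi.mul_apply, mul_assoc, ← ENNReal.rpow_add _ _ h0 hT]
    simp
  have h2 := ENNReal.lintegral_mul_le_Lp_mul_Lq μ hpq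
    (f := fun s => g s * H s ^ (-(1 / q))) (g := fun s => H s ^ (1 / q))
    (hg.mul (hH.pow_const _)).aemeasurable (hH.pow_const _).aemeasurable
  rw [← e1] at h2
  have h3 := ENNReal.rpow_le_rpow h2 hp0.le
  refine h3.trans_eq ?_
  rw [ENNReal.mul_rpow_of_nonneg _ _ hp0.le, ← ENNReal.rpow_mul, ← ENNReal.rpow_mul,
    one_div_mul_cancel hp0.ne', ENNReal.rpow_one]
  congr 1
  · refine lintegral_congr fun s => ?_
    rw [ENNReal.mul_rpow_of_nonneg _ _ hp0.le, ← ENNReal.rpow_mul]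
    congr 2
    rw [hq]; field_simp
  · have : 1 / q * p = p - 1 := by rw [hq]; field_simp
    rw [this]
    congr 1
    refine lintegral_congr fun s => ?_
    rw [← ENNReal.rpow_mul, one_div_mul_cancel hq0.ne', ENNReal.rpow_one]

/-- A positive test function `w` with derivative `h` certifies the constant `L`. Hölder with weight
`h` bounds the primitive of `g`, Tonelli exchanges the two integrations, and `hL`, an integrated
supersolution condition, bounds the inner integral. -/
theorem halfIneq_of_test {p κ L a : ℝ} (hp : 1 < p) {h w : ℝ → ℝ} (hm : Measurable h)
    (wm : Measurable w) (hpos : ∀ s ∈ Ioo 0 a, 0 < h s)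
    (hw : ∀ t ∈ Ioo 0 a, ∫⁻ s in Ioo 0 t, ENNReal.ofReal (h s) = ENNReal.ofReal (w t))
    (hL : ∀ s ∈ Ioo 0 a, ENNReal.ofReal L *
      ∫⁻ t in Ioo s a, ENNReal.ofReal (w t) ^ (p - 1) * ENNReal.ofReal (rho κ t)
        ≤ ENNReal.ofReal (h s) ^ (p - 1) * ENNReal.ofReal (rho κ s)) :
    HalfIneq p κ L (Ioo 0 a) := by
  intro g hg
  set H : ℝ → ENNReal := fun s => ENNReal.ofReal (h s) with hHdef
  have hH : Measurable H := hm.ennreal_ofReal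
  set K : ℝ → ENNReal := fun s => g s ^ p * H s ^ (-(p - 1)) with hK
  have hKm : Measurable K := (hg.pow_const _).mul (hH.pow_const _)
  set M : ℝ → ENNReal := fun t => ENNReal.ofReal (w t) ^ (p - 1) * ENNReal.ofReal (rho κ t) with hM
  have hMm : Measurable M := (wm.ennreal_ofReal.pow_const _).mul (measurable_ofReal_rho κ)
  set F : ℝ → ℝ → ENNReal := fun t s => if s < t then K s * M t else 0 with hF
  have hFm : Measurable (Function.uncurry F) := by
    refine Measurable.ite (measurableSet_lt measurable_snd measurable_fst) ?_ measurable_const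
    exact (hKm.comp measurable_snd).mul (hMm.comp measurable_fst)
  have step1 : ∀ t ∈ Ioo 0 a, (∫⁻ s in Ioo 0 t, g s) ^ p * ENNReal.ofReal (rho κ t)
      ≤ ∫⁻ s in Ioo 0 a, F t s := by
    intro t ht
    have e : ∫⁻ s in Ioo 0 a, F t s = (∫⁻ s in Ioo 0 t, K s) * M t := by
      have : F t = (Iio t).indicator fun s => K s * M t := by
        ext s; simp [hF, indicator_apply]
      rw [this, setLIntegral_indicator measurableSet_Iio, Iio_inter_Ioo, min_eq_left ht.2.le,
        lintegral_mul_const _ hKm]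
    have hsub : ∀ᵐ s ∂(volume.restrict (Ioo 0 t)), 0 < h s :=
      (ae_restrict_iff' measurableSet_Ioo).2
        (Filter.Eventually.of_forall fun s hs => hpos s ⟨hs.1, hs.2.trans ht.2⟩)
    have hh := rpow_lintegral_le_mul_rpow hp (μ := volume.restrict (Ioo 0 t)) hg hH
      (by filter_upwards [hsub] with s hs; simpa [hHdef] using hs) (by simp [hHdef])
    rw [e, hM]
    rw [hw t ht] at hh
    rw [← mul_assoc]
    gcongr
  calc ENNReal.ofReal L * ∫⁻ t in Ioo 0 a, (∫⁻ s in Ioo 0 t, g s) ^ p * ENNReal.ofReal (rho κ t)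
      ≤ ENNReal.ofReal L * ∫⁻ t in Ioo 0 a, ∫⁻ s in Ioo 0 a, F t s := by
        gcongr ENNReal.ofReal L * ?_
        exact setLIntegral_mono' measurableSet_Ioo step1
    _ = ENNReal.ofReal L * ∫⁻ s in Ioo 0 a, ∫⁻ t in Ioo 0 a, F t s := by
        rw [lintegral_lintegral_swap hFm.aemeasurable]
    _ = ∫⁻ s in Ioo 0 a, ENNReal.ofReal L * ∫⁻ t in Ioo 0 a, F t s := by
        rw [lintegral_const_mul']
        simp
    _ ≤ ∫⁻ s in Ioo 0 a, g s ^ p * ENNReal.ofReal (rho κ s) := by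
        refine setLIntegral_mono' measurableSet_Ioo fun s hs => ?_
        have e : ∫⁻ t in Ioo 0 a, F t s = K s * ∫⁻ t in Ioo s a, M t := by
          have : (fun t => F t s) = (Ioi s).indicator fun t => K s * M t := by
            ext t; simp [hF, indicator_apply]
          rw [this, setLIntegral_indicator measurableSet_Ioi, inter_comm, Ioo_inter_Ioi,
            max_eq_right hs.1.le, lintegral_const_mul _ hMm]
        rw [e, mul_left_comm]
        have h0 : H s ≠ 0 := by simpa [hHdef] using hpos s hs
        calc K s * (ENNReal.ofReal L * ∫⁻ t in Ioo s a, M t)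
            ≤ K s * (H s ^ (p - 1) * ENNReal.ofReal (rho κ s)) := by
              exact mul_le_mul_right (hL s hs) _
          _ = g s ^ p * (H s ^ (-(p - 1)) * H s ^ (p - 1)) * ENNReal.ofReal (rho κ s) := by
              rw [hK]; ring
          _ = _ := by
              rw [← ENNReal.rpow_add _ _ h0 (by simp [hHdef])]
              simp

theorem HalfIneq.mono {p κ L L' : ℝ} {J : Set ℝ} (h : HalfIneq p κ L J) (hL : L' ≤ L) :
    HalfIneq p κ L' J := by
  intro g hg
  refine le_trans ?_ (h g hg)
  gcongr

theorem halfIneq_Ioi {p κ L : ℝ} (h : ∀ a, 0 < a → HalfIneq p κ L (Ioo 0 a)) :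
    HalfIneq p κ L (Ioi 0) := by
  intro g hg
  have hU : Ioi (0 : ℝ) = ⋃ n : ℕ, Ioo (0 : ℝ) (n + 1) := by
    ext x
    simp only [mem_Ioi, mem_iUnion, mem_Ioo]
    refine ⟨fun hx => ?_, fun ⟨n, hn⟩ => hn.1⟩
    obtain ⟨n, hn⟩ := exists_nat_gt x
    exact ⟨n, hx, by linarith⟩
  have hd : Directed (· ⊆ ·) fun n : ℕ => Ioo (0 : ℝ) (n + 1) := by
    refine Monotone.directed_le fun m n hmn => Ioo_subset_Ioo_right ?_
    have : (m : ℝ) ≤ n := by exact_mod_cast hmn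
    linarith
  conv_lhs => rw [hU, setLIntegral_iUnion_of_directed _ hd, ENNReal.mul_iSup]
  refine iSup_le fun n => (h _ (by positivity) g hg).trans ?_
  exact lintegral_mono_set fun x hx => hx.1

theorem lintegral_rho_ne_top {κ : ℝ} (hκ : 0 < κ) (s : Set ℝ) :
    ∫⁻ t in s, ENNReal.ofReal (rho κ t) ≠ ⊤ :=
  ((setLIntegral_le_lintegral _ _).trans_lt
    (integrable_rho hκ).lintegral_lt_top).ne

theorem lintegral_rho_ne_zero (κ : ℝ) {a b : ℝ} (hab : a < b) :
    ∫⁻ t in Ioo a b, ENNReal.ofReal (rho κ t) ≠ 0 := by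
  rw [← pos_iff_ne_zero, setLIntegral_pos_iff (measurable_ofReal_rho κ)]
  have : Function.support (fun t => ENNReal.ofReal (rho κ t)) = univ := by
    ext t; simp [rho_pos]
  rw [this, univ_inter, Real.volume_Ioo]
  simpa using hab

/-- Extend `g` from `(0, b)` by zero: the right side is unchanged, while the primitive keeps its
final value on `(b, a)` and so adds a definite amount to the left side. -/
theorem HalfIneq.exists_lt {p κ L a b : ℝ} (hp : 1 < p) (hκ : 0 < κ) (hL : 0 < L)
    (h : HalfIneq p κ L (Ioo 0 a)) (hb : 0 < b) (hba : b < a) :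
    ∃ L', L < L' ∧ HalfIneq p κ L' (Ioo 0 b) := by
  have hp0 : 0 < p := by linarith
  set A := ∫⁻ t in Ioo 0 b, ENNReal.ofReal (rho κ t) with hA
  set B := ∫⁻ t in Ioo b a, ENNReal.ofReal (rho κ t) with hB
  have hA0 : A ≠ 0 := lintegral_rho_ne_zero κ hb
  have hAT : A ≠ ⊤ := lintegral_rho_ne_top hκ _
  have hB0 : B ≠ 0 := lintegral_rho_ne_zero κ hba
  have hBT : B ≠ ⊤ := lintegral_rho_ne_top hκ _
  have hc : 0 < (B / A).toReal :=
    ENNReal.toReal_pos (ENNReal.div_pos hB0 hAT).ne' (ENNReal.div_ne_top hBT hA0)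
  -- `A` and `B` are the masses of `(0, b)` and `(b, a)`. Since the primitive is at most its value
  -- at `b`, the integral `X` over `(0, b)` is at most `Φ b ^ p * A`, so the contribution `Φ b ^ p *
  -- B` of `(b, a)` is at least `(B / A) * X`.
  refine ⟨L * (1 + (B / A).toReal), by nlinarith, fun g hg => ?_⟩
  set g' : ℝ → ENNReal := (Ioo 0 b).indicator g with hg'
  have hgm : Measurable g' := hg.indicator measurableSet_Ioo
  have key := h g' hgm
  have e1 : ∫⁻ t in Ioo 0 a, g' t ^ p * ENNReal.ofReal (rho κ t)
      = ∫⁻ t in Ioo 0 b, g t ^ p * ENNReal.ofReal (rho κ t) := by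
    have : (fun t => g' t ^ p * ENNReal.ofReal (rho κ t))
        = (Ioo 0 b).indicator fun t => g t ^ p * ENNReal.ofReal (rho κ t) := by
      ext t
      by_cases ht : t ∈ Ioo 0 b
      · simp [hg', ht]
      · simp only [hg', indicator_of_notMem ht, ENNReal.zero_rpow_of_pos hp0, zero_mul]
    rw [this, setLIntegral_indicator measurableSet_Ioo,
      inter_eq_left.2 (Ioo_subset_Ioo_right hba.le)]
  rw [e1] at key
  refine le_trans ?_ key
  set Φ : ℝ → ENNReal := fun t => ∫⁻ s in Ioo 0 t, g s
  have e2 : ∀ t, t ≤ b → ∫⁻ s in Ioo 0 t, g' s = Φ t := by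
    intro t ht
    rw [hg', setLIntegral_indicator measurableSet_Ioo,
      inter_eq_right.2 (Ioo_subset_Ioo_right ht)]
  have e3 : ∀ t, b ≤ t → ∫⁻ s in Ioo 0 t, g' s = Φ b := by
    intro t ht
    rw [hg', setLIntegral_indicator measurableSet_Ioo,
      inter_eq_left.2 (Ioo_subset_Ioo_right ht)]
  set X := ∫⁻ t in Ioo 0 b, Φ t ^ p * ENNReal.ofReal (rho κ t) with hX
  have hXA : X ≤ Φ b ^ p * A := by
    rw [hX, hA, ← lintegral_const_mul _ (measurable_ofReal_rho κ)]
    refine setLIntegral_mono' measurableSet_Ioo fun t ht => ?_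
    gcongr
    exact lintegral_mono_set (Ioo_subset_Ioo_right ht.2.le)
  have hsum : X + Φ b ^ p * B
      ≤ ∫⁻ t in Ioo 0 a, (∫⁻ s in Ioo 0 t, g' s) ^ p * ENNReal.ofReal (rho κ t) := by
    have hd : Disjoint (Ioo 0 b) (Ioo b a) :=
      disjoint_left.2 fun t h1 h2 => lt_asymm h1.2 h2.1
    have hsub : Ioo 0 b ∪ Ioo b a ⊆ Ioo 0 a :=
      union_subset (Ioo_subset_Ioo_right hba.le) (Ioo_subset_Ioo_left hb.le)
    refine le_trans ?_ (lintegral_mono_set hsub)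
    rw [lintegral_union measurableSet_Ioo hd]
    refine add_le_add ?_ ?_
    · refine (setLIntegral_congr_fun measurableSet_Ioo fun t ht => ?_).le
      simp only [e2 t ht.2.le]
    · rw [hB, ← lintegral_const_mul _ (measurable_ofReal_rho κ)]
      refine (setLIntegral_congr_fun measurableSet_Ioo fun t ht => ?_).le
      simp only [e3 t ht.1.le]
  refine le_trans ?_ (mul_le_mul_right hsum _)
  rw [ENNReal.ofReal_mul hL.le, ENNReal.ofReal_add zero_le_one hc.le, ENNReal.ofReal_one,
    ENNReal.ofReal_toReal (ENNReal.div_ne_top hBT hA0), mul_assoc]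
  refine mul_le_mul_right ?_ _
  rw [add_mul, one_mul]
  refine add_le_add le_rfl ?_
  calc B / A * X ≤ B / A * (Φ b ^ p * A) := by gcongr
    _ = Φ b ^ p * (B / A * A) := by ring
    _ = Φ b ^ p * B := by rw [ENNReal.div_mul_cancel hA0 hAT]

/-- A crude positive constant, from the test function `w(t) = t`. It will cover the case `lambdaZero
= 0`, whose exclusion is thereby never needed. -/
theorem exists_halfIneq {p κ a : ℝ} (hp : 1 < p) (hκ : 0 < κ) (ha : 0 < a) :
    ∃ L, 0 < L ∧ HalfIneq p κ L (Ioo 0 a) := by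
  refine ⟨rho κ a / a ^ p, div_pos (rho_pos _ _) (by positivity), ?_⟩
  refine halfIneq_of_test hp (h := fun _ => 1) (w := fun t => t) measurable_const measurable_id
    (fun _ _ => one_pos) (fun t ht => by simp) fun s hs => ?_
  have h1 : ∫⁻ t in Ioo s a, ENNReal.ofReal t ^ (p - 1) * ENNReal.ofReal (rho κ t)
      ≤ ENNReal.ofReal (a ^ p) := by
    calc ∫⁻ t in Ioo s a, ENNReal.ofReal t ^ (p - 1) * ENNReal.ofReal (rho κ t)
        ≤ ∫⁻ t in Ioo s a, ENNReal.ofReal (a ^ (p - 1)) := by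
          refine setLIntegral_mono' measurableSet_Ioo fun t ht => ?_
          have ht0 : 0 ≤ t := hs.1.le.trans ht.1.le
          rw [ENNReal.ofReal_rpow_of_nonneg ht0 (by linarith),
            ← ENNReal.ofReal_mul (by positivity)]
          apply ENNReal.ofReal_le_ofReal
          have h1 : t ^ (p - 1) ≤ a ^ (p - 1) := Real.rpow_le_rpow ht0 ht.2.le (by linarith)
          have h2 : 0 ≤ t ^ (p - 1) := by positivity
          nlinarith [rho_le_one hκ t, rho_pos κ t]
      _ = ENNReal.ofReal (a ^ (p - 1) * (a - s)) := by
          rw [setLIntegral_const, Real.volume_Ioo, ENNReal.ofReal_mul (by positivity)]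
      _ ≤ _ := by
          apply ENNReal.ofReal_le_ofReal
          have : a ^ p = a ^ (p - 1) * a := by
            rw [← Real.rpow_add_one ha.ne']; ring_nf
          rw [this]
          have : 0 < a ^ (p - 1) := by positivity
          nlinarith [hs.1]
  calc _ ≤ ENNReal.ofReal (rho κ a / a ^ p) * ENNReal.ofReal (a ^ p) := by gcongr
    _ = ENNReal.ofReal (rho κ a) := by
      rw [← ENNReal.ofReal_mul (div_nonneg (rho_pos _ _).le (by positivity)),
        div_mul_cancel₀ _ (by positivity)]
    _ ≤ _ := by
      simp only [ENNReal.ofReal_one, ENNReal.one_rpow, one_mul]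
      apply ENNReal.ofReal_le_ofReal
      rw [rho, rho, Real.exp_le_exp]
      have : s ^ 2 ≤ a ^ 2 := pow_le_pow_left₀ hs.1.le hs.2.le 2
      nlinarith

/-! ### Weak derivatives in one dimension -/

theorem exists_Icc_subset_of_isCompact {s K : Set ℝ} (hs : IsOpen s) (hc : s.OrdConnected)
    (h0 : (0 : ℝ) ∈ s) (hK : IsCompact K) (hKs : K ⊆ s) :
    ∃ c d, c < 0 ∧ 0 < d ∧ K ⊆ Ioo c d ∧ Icc c d ⊆ s := by
  have hK' : IsCompact (insert 0 K) := hK.insert 0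
  have hne : (insert 0 K).Nonempty := ⟨0, mem_insert _ _⟩
  have hsub : insert 0 K ⊆ s := insert_subset h0 hKs
  obtain ⟨m, hm, hmin⟩ := hK'.exists_isLeast hne
  obtain ⟨M, hM, hmax⟩ := hK'.exists_isGreatest hne
  obtain ⟨c, hcm, hcs⟩ : ∃ c, c < m ∧ c ∈ s := by
    obtain ⟨e, he, hb⟩ := Metric.isOpen_iff.1 hs m (hsub hm)
    exact ⟨m - e / 2, by linarith, hb (by rw [Metric.mem_ball, Real.dist_eq, abs_lt]; constructor <;> linarith)⟩
  obtain ⟨d, hMd, hds⟩ : ∃ d, M < d ∧ d ∈ s := by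
    obtain ⟨e, he, hb⟩ := Metric.isOpen_iff.1 hs M (hsub hM)
    exact ⟨M + e / 2, by linarith, hb (by rw [Metric.mem_ball, Real.dist_eq, abs_lt]; constructor <;> linarith)⟩
  refine ⟨c, d, hcm.trans_le (hmin (mem_insert _ _)), (hmax (mem_insert _ _)).trans_lt hMd, ?_,
    hc.out hcs hds⟩
  intro x hx
  exact ⟨hcm.trans_le (hmin (mem_insert_of_mem _ hx)),
    (hmax (mem_insert_of_mem _ hx)).trans_lt hMd⟩

theorem setIntegral_eq_intervalIntegral_of_support {s : Set ℝ} {c d : ℝ} (hcd : c ≤ d)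
    (hs : Icc c d ⊆ s) {f : ℝ → ℝ} (hf : ∀ x, x ∉ Ioo c d → f x = 0) :
    ∫ x in s, f x = ∫ x in c..d, f x := by
  rw [setIntegral_eq_integral_of_forall_compl_eq_zero
      (fun x hx => hf x fun h => hx (hs (Ioo_subset_Icc_self h))),
    intervalIntegral.integral_of_le hcd,
    setIntegral_eq_integral_of_forall_compl_eq_zero
      (fun x hx => hf x fun h => hx (Ioo_subset_Ioc_self h))]

theorem integral_primitive_mul_deriv {s : Set ℝ} (hs : IsOpen s) (hc : s.OrdConnected)
    (h0 : (0 : ℝ) ∈ s) {g : ℝ → ℝ} (hg : LocallyIntegrableOn g s) {ψ : ℝ → ℝ}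
    (hψ : ContDiff ℝ ∞ ψ) (hcs : HasCompactSupport ψ) (hsub : tsupport ψ ⊆ s) :
    ∫ t in s, (∫ x in (0 : ℝ)..t, g x) * deriv ψ t = -∫ t in s, g t * ψ t := by
  obtain ⟨c, d, hc0, hd0, hK, hI⟩ := exists_Icc_subset_of_isCompact hs hc h0 hcs hsub
  have hcd : c ≤ d := by linarith
  have z1 : ∀ x, x ∉ Ioo c d → ψ x = 0 := fun x hx =>
    image_eq_zero_of_notMem_tsupport fun h => hx (hK h)
  have z2 : ∀ x, x ∉ Ioo c d → deriv ψ x = 0 := fun x hx =>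
    image_eq_zero_of_notMem_tsupport fun h => hx (hK (tsupport_deriv_subset h))
  rw [setIntegral_eq_intervalIntegral_of_support hcd hI (fun x hx => by simp [z2 x hx]),
    setIntegral_eq_intervalIntegral_of_support hcd hI (fun x hx => by simp [z1 x hx])]
  have hgi : IntervalIntegrable g volume c d := by
    rw [intervalIntegrable_iff_integrableOn_Icc_of_le hcd]
    exact hg.integrableOn_compact_subset hI isCompact_Icc
  have h0m : (0 : ℝ) ∈ uIcc c d := by rw [uIcc_of_le hcd]; exact ⟨hc0.le, hd0.le⟩
  have hψac : AbsolutelyContinuousOnInterval ψ c d := by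
    have hint : IntervalIntegrable (deriv ψ) volume c d :=
      (hψ.continuous_deriv (by simp)).intervalIntegrable _ _
    have := hint.absolutelyContinuousOnInterval_intervalIntegral (c := c) left_mem_uIcc
    have e : (fun x => ∫ v in c..x, deriv ψ v) = ψ := by
      ext x
      rw [intervalIntegral.integral_deriv_eq_sub
        (fun y _ => (hψ.differentiable (by simp)).differentiableAt)
        ((hψ.continuous_deriv (by simp)).intervalIntegrable _ _), z1 c (by simp), sub_zero]
    rwa [e] at this
  rw [(hgi.absolutelyContinuousOnInterval_intervalIntegral h0m).integral_mul_deriv_eq_deriv_mul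
    hψac, z1 c (by simp), z1 d (by simp)]
  simp only [mul_zero, sub_self, zero_sub, neg_inj]
  refine intervalIntegral.integral_congr_ae ?_
  filter_upwards [hgi.ae_hasDerivAt_integral] with x hx hxm
  rw [(hx (uIoc_subset_uIcc hxm) 0 h0m).deriv]

theorem exists_test_integral_eq_one {s : Set ℝ} (hs : IsOpen s) (h0 : (0 : ℝ) ∈ s) :
    ∃ η : ℝ → ℝ, ContDiff ℝ ∞ η ∧ HasCompactSupport η ∧ tsupport η ⊆ s ∧ ∫ x, η x = 1 := by
  obtain ⟨e, he, hb⟩ := Metric.isOpen_iff.1 hs 0 h0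
  let b : ContDiffBump (0 : ℝ) := ⟨e / 4, e / 2, by linarith, by linarith⟩
  refine ⟨b.normed volume, b.contDiff_normed, b.hasCompactSupport_normed, ?_, b.integral_normed⟩
  rw [b.tsupport_normed_eq]
  exact (Metric.closedBall_subset_ball (by simp only [b]; linarith)).trans hb

theorem integrableOn_mul_test {s : Set ℝ} {f ψ : ℝ → ℝ} (hf : LocallyIntegrableOn f s)
    (hψ : Continuous ψ) (hψc : HasCompactSupport ψ) (hψs : tsupport ψ ⊆ s) :
    IntegrableOn (fun t => f t * ψ t) s := by
  have h1 : IntegrableOn (fun t => f t * ψ t) (tsupport ψ) :=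
    (hf.integrableOn_compact_subset hψs hψc).mul_continuousOn hψ.continuousOn hψc
  have h2 : Integrable (fun t => f t * ψ t) :=
    (integrableOn_iff_integrable_of_support_subset fun x hx =>
      subset_tsupport ψ (right_ne_zero_of_mul hx)).1 h1
  exact h2.integrableOn

/-- The du Bois-Reymond lemma: a test function of mean zero is the derivative of a test function,
and any `ψ` acquires mean zero after subtracting `(∫ ψ) η` with `∫ η = 1`. -/
theorem ae_eq_const_of_integral_mul_deriv_eq_zero {s : Set ℝ} (hs : IsOpen s) (hc : s.OrdConnected)
    (h0 : (0 : ℝ) ∈ s) {f : ℝ → ℝ} (hf : LocallyIntegrableOn f s)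
    (h : ∀ ψ : ℝ → ℝ, ContDiff ℝ ∞ ψ → HasCompactSupport ψ → tsupport ψ ⊆ s →
      ∫ t in s, f t * deriv ψ t = 0) :
    ∃ C : ℝ, ∀ᵐ t, t ∈ s → f t = C := by
  obtain ⟨η, hη, hηc, hηs, hη1⟩ := exists_test_integral_eq_one hs h0
  have hmul : ∀ ψ : ℝ → ℝ, ContDiff ℝ ∞ ψ → HasCompactSupport ψ → tsupport ψ ⊆ s →
      IntegrableOn (fun t => f t * ψ t) s :=
    fun ψ hψ => integrableOn_mul_test hf hψ.continuous
  refine ⟨∫ t in s, f t * η t, ?_⟩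
  set C := ∫ t in s, f t * η t with hC
  have key := hs.ae_eq_zero_of_integral_contDiff_smul_eq_zero (μ := volume)
    (f := fun t => f t - C) (hf.sub (locallyIntegrableOn_const C)) ?_
  · filter_upwards [key] with t ht hts
    linarith [ht hts]
  intro ψ hψ hψc hψs
  set I := ∫ x, ψ x with hI
  set χ : ℝ → ℝ := fun t => ψ t - I * η t with hχ
  have hχd : ContDiff ℝ ∞ χ := hψ.sub (contDiff_const.mul hη)
  obtain ⟨c, d, hc0, hd0, hK, hIs⟩ := exists_Icc_subset_of_isCompact hs hc h0
    (hψc.isCompact.union hηc.isCompact) (union_subset hψs hηs)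
  have z1 : ∀ x, x ∉ Ioo c d → ψ x = 0 := fun x hx =>
    image_eq_zero_of_notMem_tsupport fun h => hx (hK (Or.inl h))
  have z2 : ∀ x, x ∉ Ioo c d → η x = 0 := fun x hx =>
    image_eq_zero_of_notMem_tsupport fun h => hx (hK (Or.inr h))
  have z3 : ∀ x, x ∉ Ioo c d → χ x = 0 := fun x hx => by simp [hχ, z1 x hx, z2 x hx]
  set Ψ : ℝ → ℝ := fun t => ∫ x in c..t, χ x with hΨ
  have hder : ∀ t, HasDerivAt Ψ (χ t) t := fun t =>
    intervalIntegral.integral_hasDerivAt_right (hχd.continuous.intervalIntegrable _ _)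
      (hχd.continuous.stronglyMeasurableAtFilter _ _) hχd.continuous.continuousAt
  have hderiv : deriv Ψ = χ := funext fun t => (hder t).deriv
  have hΨd : ContDiff ℝ ∞ Ψ := by
    rw [contDiff_infty_iff_deriv, hderiv]
    exact ⟨fun t => (hder t).differentiableAt, hχd⟩
  have hlow : ∀ t, t ≤ c → Ψ t = 0 := by
    intro t ht
    rw [hΨ]
    refine intervalIntegral.integral_zero_ae (Filter.Eventually.of_forall fun x hx => z3 x ?_)
    rw [uIoc_of_ge ht] at hx
    exact fun h => by linarith [h.1, hx.2]
  have hd : Ψ d = 0 := by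
    have e1 : ∫ x, ψ x = ∫ x in c..d, ψ x := by
      rw [← setIntegral_univ]
      exact setIntegral_eq_intervalIntegral_of_support (by linarith) (subset_univ _) z1
    have e2 : ∫ x, η x = ∫ x in c..d, η x := by
      rw [← setIntegral_univ]
      exact setIntegral_eq_intervalIntegral_of_support (by linarith) (subset_univ _) z2
    simp only [hΨ, hχ]
    rw [intervalIntegral.integral_sub (hψ.continuous.intervalIntegrable _ _)
      ((hη.continuous.intervalIntegrable _ _).const_mul _), intervalIntegral.integral_const_mul,
      ← e1, ← e2, hη1, hI]
    ring
  have hhigh : ∀ t, d ≤ t → Ψ t = 0 := by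
    intro t ht
    have : Ψ t = Ψ d + ∫ x in d..t, χ x :=
      (intervalIntegral.integral_add_adjacent_intervals (hχd.continuous.intervalIntegrable _ _)
        (hχd.continuous.intervalIntegrable _ _)).symm
    rw [this, hd, zero_add]
    refine intervalIntegral.integral_zero_ae (Filter.Eventually.of_forall fun x hx => z3 x ?_)
    rw [uIoc_of_le ht] at hx
    exact fun h => by linarith [h.2, hx.1]
  have hΨsupp : tsupport Ψ ⊆ Icc c d := by
    refine closure_minimal (fun t ht => ?_) isClosed_Icc
    by_contra hn
    rw [mem_Icc, not_and_or, not_le, not_le] at hn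
    rcases hn with hn | hn
    · exact ht (hlow t hn.le)
    · exact ht (hhigh t hn.le)
  have h1 := h Ψ hΨd (HasCompactSupport.of_support_subset_isCompact isCompact_Icc
    ((subset_tsupport _).trans hΨsupp)) (hΨsupp.trans hIs)
  rw [hderiv] at h1
  have h2 : ∫ t in s, f t * χ t = (∫ t in s, f t * ψ t) - I * C := by
    have : ∀ t, f t * χ t = f t * ψ t - I * (f t * η t) := fun t => by simp only [hχ]; ring
    simp only [this]
    rw [integral_sub (hmul ψ hψ hψc hψs) ((hmul η hη hηc hηs).const_mul _), integral_const_mul]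
  have h3 : ∫ x, ψ x • (f x - C) = ∫ x in s, ψ x • (f x - C) :=
    (setIntegral_eq_integral_of_forall_compl_eq_zero fun x hx => by
      rw [image_eq_zero_of_notMem_tsupport fun h => hx (hψs h), zero_smul]).symm
  have h4 : I = ∫ x in s, ψ x :=
    (setIntegral_eq_integral_of_forall_compl_eq_zero fun x hx =>
      image_eq_zero_of_notMem_tsupport fun h => hx (hψs h)).symm
  rw [h3]
  have : ∀ x, ψ x • (f x - C) = f x * ψ x - C * ψ x := fun x => by rw [smul_eq_mul]; ring
  simp only [this]
  rw [integral_sub (hmul ψ hψ hψc hψs)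
    ((hψ.continuous.integrable_of_hasCompactSupport hψc).integrableOn.const_mul _),
    integral_const_mul, ← h4]
  linarith

theorem ofReal_rpow_abs {p : ℝ} (hp : 0 ≤ p) (x : ℝ) : ENNReal.ofReal (|x| ^ p) = ‖x‖ₑ ^ p := by
  rw [Real.enorm_eq_ofReal_abs, ENNReal.ofReal_rpow_of_nonneg (abs_nonneg x) hp]

theorem integrable_rpow_abs_of_memLp {p : ℝ} (hp : 1 < p) {μ : Measure ℝ} {f : ℝ → ℝ}
    (hf : MemLp f (ENNReal.ofReal p) μ) : Integrable (fun t => |f t| ^ p) μ := by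
  have := hf.integrable_norm_rpow (by simp; linarith) ENNReal.ofReal_ne_top
  simpa [ENNReal.toReal_ofReal (by linarith : (0 : ℝ) ≤ p)] using this

theorem ofReal_integral_rpow_abs {p : ℝ} (hp : 1 < p) {μ : Measure ℝ} {f : ℝ → ℝ}
    (hf : MemLp f (ENNReal.ofReal p) μ) :
    ENNReal.ofReal (∫ t, |f t| ^ p ∂μ) = ∫⁻ t, ‖f t‖ₑ ^ p ∂μ := by
  rw [ofReal_integral_eq_lintegral_ofReal (integrable_rpow_abs_of_memLp hp hf)
    (Filter.Eventually.of_forall fun t => by positivity)]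
  simp only [ofReal_rpow_abs (by linarith : (0 : ℝ) ≤ p)]

theorem locallyIntegrableOn_of_memLp_weight {p κ : ℝ} (hp : 1 < p) (hκ : 0 < κ) {s : Set ℝ}
    (hs : IsOpen s) {f : ℝ → ℝ} (hf : MemLp f (ENNReal.ofReal p) (weight κ s)) :
    LocallyIntegrableOn f s := by
  have := isFiniteMeasure_weight hκ s
  have h1 : Integrable f (weight κ s) := hf.integrable (by simpa using hp.le)
  rw [integrable_weight_iff] at h1
  have h2 := h1.locallyIntegrableOn.mul_continuousOn (g := fun t => (rho κ t)⁻¹)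
    ((continuous_rho κ).inv₀ fun t => (rho_pos κ t).ne').continuousOn hs.isLocallyClosed
  refine h2.congr ?_
  filter_upwards with t
  rw [mul_assoc, mul_inv_cancel₀ (rho_pos κ t).ne', mul_one]

theorem continuousOn_primitive {s : Set ℝ} (hs : IsOpen s) (hc : s.OrdConnected)
    (h0 : (0 : ℝ) ∈ s) {g : ℝ → ℝ} (hg : LocallyIntegrableOn g s) :
    ContinuousOn (fun t => ∫ x in (0 : ℝ)..t, g x) s := by
  intro x hx
  obtain ⟨c, d, hc0, hd0, hK, hI⟩ := exists_Icc_subset_of_isCompact hs hc h0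
    (isCompact_singleton (x := x)) (singleton_subset_iff.2 hx)
  have hxm : x ∈ Ioo c d := hK rfl
  have hcd : c ≤ d := by linarith
  have hgi : IntervalIntegrable g volume c d := by
    rw [intervalIntegrable_iff_integrableOn_Icc_of_le hcd]
    exact hg.integrableOn_compact_subset hI isCompact_Icc
  have h0m : (0 : ℝ) ∈ uIcc c d := by rw [uIcc_of_le hcd]; exact ⟨hc0.le, hd0.le⟩
  have := (hgi.absolutelyContinuousOnInterval_intervalIntegral h0m).continuousOn
  rw [uIcc_of_le hcd] at this
  exact (this.continuousAt (Icc_mem_nhds hxm.1 hxm.2)).continuousWithinAt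

/-- The difference between `φ` and the primitive of `g` has zero weak derivative. The constant `C`
plays the role of `φ(0)`, so that `φ - C` is accessible to the Hardy inequality. -/
theorem IsSobolev.exists_eq_primitive {p κ : ℝ} (hp : 1 < p) (hκ : 0 < κ) {s : Set ℝ}
    (hs : IsOpen s) (hc : s.OrdConnected) (h0 : (0 : ℝ) ∈ s) {φ g : ℝ → ℝ}
    (h : IsSobolev p κ s φ g) :
    ∃ C : ℝ, ∀ᵐ t, t ∈ s → φ t - C = ∫ x in (0 : ℝ)..t, g x := by
  have hφ := locallyIntegrableOn_of_memLp_weight hp hκ hs h.memLp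
  have hg := locallyIntegrableOn_of_memLp_weight hp hκ hs h.memLp_deriv
  have hG : LocallyIntegrableOn (fun t => ∫ x in (0 : ℝ)..t, g x) s :=
    (continuousOn_primitive hs hc h0 hg).locallyIntegrableOn hs.measurableSet
  obtain ⟨C, hC⟩ := ae_eq_const_of_integral_mul_deriv_eq_zero hs hc h0 (hφ.sub hG) (by
    intro ψ hψ hψc hψs
    have hd : Continuous (deriv ψ) := hψ.continuous_deriv (by simp)
    have hds : tsupport (deriv ψ) ⊆ s := tsupport_deriv_subset.trans hψs
    simp only [Pi.sub_apply, sub_mul]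
    rw [integral_sub (integrableOn_mul_test hφ hd hψc.deriv hds)
      (integrableOn_mul_test hG hd hψc.deriv hds), h.weak_deriv ψ hψ hψc hψs,
      integral_primitive_mul_deriv hs hc h0 hg hψ hψc hψs, sub_self])
  refine ⟨C, ?_⟩
  filter_upwards [hC] with t ht hts
  have := ht hts
  simp only [Pi.sub_apply] at this
  linarith

theorem isSobolev_of_primitive {p κ : ℝ} (hp : 1 < p) (hκ : 0 < κ) {s : Set ℝ}
    (hs : IsOpen s) (hc : s.OrdConnected) (h0 : (0 : ℝ) ∈ s) {φ g : ℝ → ℝ}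
    (hφ : MemLp φ (ENNReal.ofReal p) (weight κ s)) (hg : MemLp g (ENNReal.ofReal p) (weight κ s))
    {C : ℝ} (h : ∀ t ∈ s, φ t = C + ∫ x in (0 : ℝ)..t, g x) : IsSobolev p κ s φ g := by
  refine ⟨hφ, hg, fun ψ hψ hψc hψs => ?_⟩
  have hd : Continuous (deriv ψ) := hψ.continuous_deriv (by simp)
  have hds : tsupport (deriv ψ) ⊆ s := tsupport_deriv_subset.trans hψs
  have hgl := locallyIntegrableOn_of_memLp_weight hp hκ hs hg
  have hG : LocallyIntegrableOn (fun t => ∫ x in (0 : ℝ)..t, g x) s :=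
    (continuousOn_primitive hs hc h0 hgl).locallyIntegrableOn hs.measurableSet
  have hz : ∫ t in s, deriv ψ t = 0 := by
    rw [setIntegral_eq_integral_of_forall_compl_eq_zero fun x hx =>
      image_eq_zero_of_notMem_tsupport fun h => hx (hds h)]
    exact integral_eq_zero_of_hasDerivAt_of_integrable
      (fun x => (hψ.differentiable (by simp) x).hasDerivAt)
      (hd.integrable_of_hasCompactSupport hψc.deriv)
      (hψ.continuous.integrable_of_hasCompactSupport hψc)
  rw [← integral_primitive_mul_deriv hs hc h0 hgl hψ hψc hψs]
  have : ∫ t in s, φ t * deriv ψ t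
      = ∫ t in s, (C * deriv ψ t + (∫ x in (0 : ℝ)..t, g x) * deriv ψ t) :=
    setIntegral_congr_fun hs.measurableSet fun t ht => by simp only [h t ht]; ring
  rw [this, integral_add ((hd.integrable_of_hasCompactSupport hψc.deriv).integrableOn.const_mul C)
    (integrableOn_mul_test hG hd hψc.deriv hds), integral_const_mul, hz]
  ring

/-! ### Hardy inequality and Rayleigh quotient -/

theorem setLIntegral_eq_add_reflect {s : Set ℝ} (hsymm : ∀ x ∈ s, -x ∈ s) (f : ℝ → ENNReal) :
    ∫⁻ t in s, f t = (∫⁻ t in s ∩ Ioi 0, f t) + ∫⁻ t in s ∩ Ioi 0, f (-t) := by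
  have h1 : ∫⁻ t in s ∩ Ioi 0, f (-t) = ∫⁻ t in s ∩ Iio 0, f t := by
    have := (Measure.measurePreserving_neg (volume : Measure ℝ)).setLIntegral_comp_preimage_emb
      (MeasurableEquiv.neg ℝ).measurableEmbedding f (s ∩ Iio 0)
    rw [← this]
    congr 2
    ext x
    simp only [mem_inter_iff, mem_Ioi, mem_preimage, mem_Iio, Left.neg_neg_iff]
    exact ⟨fun h => ⟨hsymm _ h.1, h.2⟩, fun h => ⟨by simpa using hsymm _ h.1, h.2⟩⟩
  have h2 : ∫⁻ t in s ∩ Iio 0, f t = ∫⁻ t in s ∩ Iic 0, f t :=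
    setLIntegral_congr (Filter.EventuallyEq.inter (Filter.EventuallyEq.refl _ _) Iio_ae_eq_Iic)
  rw [h1, h2, ← lintegral_inter_add_sdiff f s measurableSet_Ioi]
  congr 3
  ext x; simp

/-- Fold the integrals at the origin and apply the half inequality to `g(t)` and to `g(-t)`. -/
theorem HalfIneq.symm {p κ L : ℝ} {s : Set ℝ} (hsm : MeasurableSet s)
    (hsymm : ∀ x ∈ s, -x ∈ s) (h : HalfIneq p κ L (s ∩ Ioi 0)) (hp : 1 < p)
    {g : ℝ → ℝ} (hg : Measurable g) :
    ENNReal.ofReal L * ∫⁻ t, ‖∫ x in (0 : ℝ)..t, g x‖ₑ ^ p ∂(weight κ s)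
      ≤ ∫⁻ t, ‖g t‖ₑ ^ p ∂(weight κ s) := by
  have hp0 : 0 ≤ p := by linarith
  rw [lintegral_weight, lintegral_weight, setLIntegral_eq_add_reflect hsymm,
    setLIntegral_eq_add_reflect hsymm, mul_add]
  simp only [rho_neg]
  have hJ : MeasurableSet (s ∩ Ioi 0) := hsm.inter measurableSet_Ioi
  have half : ∀ f : ℝ → ℝ, Measurable f → ENNReal.ofReal L *
      ∫⁻ t in s ∩ Ioi 0, ‖∫ x in (0 : ℝ)..t, f x‖ₑ ^ p * ENNReal.ofReal (rho κ t)
        ≤ ∫⁻ t in s ∩ Ioi 0, ‖f t‖ₑ ^ p * ENNReal.ofReal (rho κ t) := by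
    intro f hf
    refine le_trans ?_ (h (fun t => ‖f t‖ₑ) hf.enorm)
    refine mul_le_mul_right (setLIntegral_mono' hJ fun t ht => ?_) _
    gcongr
    rw [intervalIntegral.integral_of_le (mem_Ioi.1 ht.2).le, integral_Ioc_eq_integral_Ioo]
    exact enorm_integral_le_lintegral_enorm _
  refine add_le_add (half g hg) ?_
  have := half (fun t => g (-t)) (hg.comp measurable_neg)
  have e : ∀ t : ℝ, ‖∫ x in (0 : ℝ)..t, g (-x)‖ₑ = ‖∫ x in (0 : ℝ)..(-t), g x‖ₑ := by
    intro t
    rw [intervalIntegral.integral_comp_neg, neg_zero, intervalIntegral.integral_symm, enorm_neg]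
  simpa only [e] using this

/-- The graph of the convex function `|·|^p` lies above its tangent at `x`; Young's inequality
supplies the proof. Integrated against the constraint, the linear term disappears. -/
theorem rpow_abs_sub_ge {p : ℝ} (hp : 1 < p) (x c : ℝ) :
    |x| ^ p - p * c * oddPow p x ≤ |x - c| ^ p := by
  have hpq : p.HolderConjugate (conjExp p) := Real.HolderConjugate.conjExponent hp
  have h := Real.young_inequality (x - c) (oddPow p x) hpq
  have hp1 : p - 1 ≠ 0 := by linarith
  rw [abs_oddPow hp, ← Real.rpow_mul (abs_nonneg x),
    show (p - 1) * conjExp p = p by rw [conjExp]; field_simp] at h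
  have e : (x - c) * oddPow p x = |x| ^ p - c * oddPow p x := by
    rw [← oddPow_mul_self hp]; ring
  rw [e] at h
  have e2 : |x| ^ p / conjExp p = |x| ^ p - |x| ^ p / p := by
    rw [conjExp]; field_simp
  rw [e2] at h
  have h3 : |x| ^ p / p - c * oddPow p x ≤ |x - c| ^ p / p := by linarith
  have h4 := mul_le_mul_of_nonneg_left h3 (by linarith : 0 ≤ p)
  have h5 : p * (|x| ^ p / p - c * oddPow p x) = |x| ^ p - p * c * oddPow p x := by
    field_simp
  have h6 : p * (|x - c| ^ p / p) = |x - c| ^ p := by field_simp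
  linarith

theorem integrable_oddPow_of_memLp {p : ℝ} (hp : 1 < p) {μ : Measure ℝ} [IsFiniteMeasure μ]
    {f : ℝ → ℝ} (hf : MemLp f (ENNReal.ofReal p) μ) : Integrable (fun t => oddPow p (f t)) μ := by
  refine ((integrable_const (1 : ℝ)).add (integrable_rpow_abs_of_memLp hp hf)).mono'
    ((continuous_oddPow hp).comp_aestronglyMeasurable hf.aestronglyMeasurable)
    (Filter.Eventually.of_forall fun t => ?_)
  rw [Real.norm_eq_abs, abs_oddPow hp, Pi.add_apply]
  rcases le_total |f t| 1 with h | h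
  · have h1 : |f t| ^ (p - 1) ≤ 1 := Real.rpow_le_one (abs_nonneg _) h (by linarith)
    have h2 : 0 ≤ |f t| ^ p := by positivity
    linarith
  · have h1 : |f t| ^ (p - 1) ≤ |f t| ^ p := Real.rpow_le_rpow_of_exponent_le h (by linarith)
    linarith

theorem integral_rpow_abs_pos {p : ℝ} (hp : 1 < p) {μ : Measure ℝ} {f : ℝ → ℝ}
    (hf : MemLp f (ENNReal.ofReal p) μ) (h : ¬ f =ᵐ[μ] 0) : 0 < ∫ t, |f t| ^ p ∂μ := by
  have h0 : 0 ≤ ∫ t, |f t| ^ p ∂μ := integral_nonneg fun t => by positivity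
  refine h0.lt_of_ne fun he => h ?_
  have := (integral_eq_zero_iff_of_nonneg (fun t => by positivity)
    (integrable_rpow_abs_of_memLp hp hf)).1 he.symm
  filter_upwards [this] with t ht
  simpa using ((Real.rpow_eq_zero_iff_of_nonneg (abs_nonneg _)).1 ht).1

theorem IsSobolev.congr_deriv {p κ : ℝ} {s : Set ℝ} {φ g g' : ℝ → ℝ} (h : IsSobolev p κ s φ g)
    (hg : g =ᵐ[weight κ s] g') : IsSobolev p κ s φ g' := by
  refine ⟨h.memLp, h.memLp_deriv.ae_eq hg, fun ψ h1 h2 h3 => ?_⟩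
  rw [h.weak_deriv ψ h1 h2 h3]
  congr 1
  refine integral_congr_ae ?_
  filter_upwards [(restrict_absolutelyContinuous_weight κ s).ae_le hg] with t ht
  rw [ht]

/-- By convexity the constraint gives `∫ |φ|^p ρ ≤ ∫ |φ - C|^p ρ` for every `C`. With `C` standing
for `φ(0)`, the right side is controlled by the symmetrised Hardy inequality. -/
theorem HalfIneq.le_of_mem_rayleighValues {p κ L : ℝ} (hp : 1 < p) (hκ : 0 < κ) (hL : 0 < L)
    {s : Set ℝ} (hs : IsOpen s) (hc : s.OrdConnected) (h0 : (0 : ℝ) ∈ s)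
    (hsymm : ∀ x ∈ s, -x ∈ s) (h : HalfIneq p κ L (s ∩ Ioi 0)) {R : ℝ}
    (hR : R ∈ rayleighValues p κ s) : L ≤ R := by
  obtain ⟨φ, g₀, hS₀, hne, hcon, rfl⟩ := hR
  have := isFiniteMeasure_weight hκ s
  -- The Hardy inequality is stated for measurable functions, hence a measurable representative.
  set g := hS₀.memLp_deriv.1.mk g₀ with hgdef
  have hgg : g₀ =ᵐ[weight κ s] g := hS₀.memLp_deriv.1.ae_eq_mk
  have hgm : Measurable g := hS₀.memLp_deriv.1.stronglyMeasurable_mk.measurable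
  have hS : IsSobolev p κ s φ g := hS₀.congr_deriv hgg
  have hY : ∫ t, |g₀ t| ^ p ∂(weight κ s) = ∫ t, |g t| ^ p ∂(weight κ s) :=
    integral_congr_ae (by filter_upwards [hgg] with t ht; rw [ht])
  rw [hY]
  obtain ⟨C, hC⟩ := hS.exists_eq_primitive hp hκ hs hc h0
  have hX := integral_rpow_abs_pos hp hS.memLp hne
  rw [le_div_iff₀ hX]
  have hψ : MemLp (fun t => φ t - C) (ENNReal.ofReal p) (weight κ s) :=
    hS.memLp.sub (memLp_const C)
  have h1 : ∫ t, |φ t| ^ p ∂(weight κ s) ≤ ∫ t, |φ t - C| ^ p ∂(weight κ s) := by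
    have e : ∫ t, |φ t| ^ p ∂(weight κ s)
        = ∫ t, (|φ t| ^ p - p * C * oddPow p (φ t)) ∂(weight κ s) := by
      rw [integral_sub (integrable_rpow_abs_of_memLp hp hS.memLp)
        ((integrable_oddPow_of_memLp hp hS.memLp).const_mul _), integral_const_mul, hcon]
      ring
    rw [e]
    exact integral_mono ((integrable_rpow_abs_of_memLp hp hS.memLp).sub
        ((integrable_oddPow_of_memLp hp hS.memLp).const_mul _))
      (integrable_rpow_abs_of_memLp hp hψ) fun t => rpow_abs_sub_ge hp _ _
  have h2 : L * ∫ t, |φ t - C| ^ p ∂(weight κ s) ≤ ∫ t, |g t| ^ p ∂(weight κ s) := by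
    rw [← ENNReal.ofReal_le_ofReal_iff (integral_nonneg fun t => by positivity),
      ENNReal.ofReal_mul hL.le, ofReal_integral_rpow_abs hp hψ,
      ofReal_integral_rpow_abs hp hS.memLp_deriv]
    refine le_trans (mul_le_mul_right (le_of_eq (lintegral_congr_ae ?_)) _)
      (h.symm hs.measurableSet hsymm hp hgm)
    have hC' : ∀ᵐ t ∂(weight κ s), φ t - C = ∫ x in (0 : ℝ)..t, g x :=
      (weight_absolutelyContinuous κ s).ae_le ((ae_restrict_iff' hs.measurableSet).2 hC)
    filter_upwards [hC'] with t ht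
    rw [ht]
  nlinarith

theorem rayleighValues_nonneg {p κ : ℝ} {s : Set ℝ} {R : ℝ} (hR : R ∈ rayleighValues p κ s) :
    0 ≤ R := by
  obtain ⟨φ, g, -, -, -, rfl⟩ := hR
  exact div_nonneg (integral_nonneg fun t => by positivity)
    (integral_nonneg fun t => by positivity)

theorem lambdaZero_nonneg (p κ : ℝ) : 0 ≤ lambdaZero p κ :=
  Real.sInf_nonneg fun _ hR => rayleighValues_nonneg hR

theorem lambdaZero_mul_lintegral_le {p κ : ℝ} (hp : 1 < p) {φ g : ℝ → ℝ}
    (h : IsSobolev p κ univ φ g) (h0 : ∫ t, oddPow p (φ t) ∂(weight κ univ) = 0) :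
    ENNReal.ofReal (lambdaZero p κ) * ∫⁻ t, ‖φ t‖ₑ ^ p ∂(weight κ univ)
      ≤ ∫⁻ t, ‖g t‖ₑ ^ p ∂(weight κ univ) := by
  by_cases hne : φ =ᵐ[weight κ univ] 0
  · have : ∫⁻ t, ‖φ t‖ₑ ^ p ∂(weight κ univ) = 0 := by
      rw [lintegral_eq_zero_iff' ((h.memLp.1.enorm).pow_const _)]
      filter_upwards [hne] with t ht
      simp [ht, ENNReal.zero_rpow_of_pos (by linarith : 0 < p)]
    rw [this, mul_zero]
    exact zero_le
  · have hR : lambdaZero p κ ≤ (∫ t, |g t| ^ p ∂(weight κ univ)) /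
        (∫ t, |φ t| ^ p ∂(weight κ univ)) :=
      csInf_le ⟨0, fun R hR => rayleighValues_nonneg hR⟩ ⟨φ, g, h, hne, h0, rfl⟩
    rw [le_div_iff₀ (integral_rpow_abs_pos hp h.memLp hne)] at hR
    rw [← ofReal_integral_rpow_abs hp h.memLp, ← ofReal_integral_rpow_abs hp h.memLp_deriv,
      ← ENNReal.ofReal_mul (lambdaZero_nonneg p κ)]
    exact ENNReal.ofReal_le_ofReal hR

theorem primitive_neg_of_even {g : ℝ → ℝ} (hev : ∀ t, g (-t) = g t) (t : ℝ) :
    ∫ x in (0 : ℝ)..(-t), g x = -∫ x in (0 : ℝ)..t, g x := by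
  have := intervalIntegral.integral_comp_neg (a := 0) (b := t) g
  simp only [hev, neg_zero] at this
  rw [this, intervalIntegral.integral_symm]

/-- An even derivative has an odd primitive, for which the constraint holds by symmetry. Vanishing
outside a bounded set keeps the primitive bounded and thus in `L^p` of the finite measure. -/
theorem isSobolev_odd_primitive {p κ b : ℝ} (hp : 1 < p) (hκ : 0 < κ) {g : ℝ → ℝ}
    (hev : ∀ t, g (-t) = g t) (hLp : MemLp g (ENNReal.ofReal p) (weight κ univ))
    (hsupp : ∀ t, b ≤ |t| → g t = 0) :
    Integrable g ∧ IsSobolev p κ univ (fun t => ∫ x in (0 : ℝ)..t, g x) g ∧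
      ∫ t, oddPow p (∫ x in (0 : ℝ)..t, g x) ∂(weight κ univ) = 0 := by
  have := isFiniteMeasure_weight hκ univ
  have hl := locallyIntegrableOn_of_memLp_weight hp hκ isOpen_univ hLp
  have hi : Integrable g := by
    rw [← integrableOn_iff_integrable_of_support_subset (s := Icc (-b) b)]
    · exact hl.integrableOn_compact_subset (subset_univ _) isCompact_Icc
    · intro t ht
      rw [mem_Icc, ← abs_le]
      by_contra hn
      exact ht (hsupp t (not_le.1 hn).le)
  have hcont : Continuous fun t => ∫ x in (0 : ℝ)..t, g x :=
    continuousOn_univ.1 (continuousOn_primitive isOpen_univ ordConnected_univ (mem_univ _) hl)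
  have hφ : MemLp (fun t => ∫ x in (0 : ℝ)..t, g x) (ENNReal.ofReal p) (weight κ univ) := by
    refine MemLp.of_bound hcont.aestronglyMeasurable (∫ x, ‖g x‖)
      (Filter.Eventually.of_forall fun t => ?_)
    refine intervalIntegral.norm_integral_le_integral_norm_uIoc.trans ?_
    exact setIntegral_le_integral hi.norm (Filter.Eventually.of_forall fun x => norm_nonneg _)
  refine ⟨hi, isSobolev_of_primitive hp hκ isOpen_univ ordConnected_univ (mem_univ _) hφ hLp
    (C := 0) fun t _ => by rw [zero_add], ?_⟩
  have hodd := primitive_neg_of_even hev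
  rw [integral_weight, setIntegral_univ]
  set f : ℝ → ℝ := fun t => oddPow p (∫ x in (0 : ℝ)..t, g x) * rho κ t with hf
  have h1 : ∫ t, f t = -∫ t, f t := by
    conv_lhs => rw [← integral_neg_eq_self]
    rw [← integral_neg]
    congr 1
    ext t
    simp only [hf, hodd, oddPow_neg, rho_neg]
    ring
  linarith

/-- Without a competitor, a lower bound for all quotients would say nothing about their `sInf`. The
one used is the odd primitive of the indicator of `(-1, 1)`. -/
theorem rayleighValues_univ_nonempty {p κ : ℝ} (hp : 1 < p) (hκ : 0 < κ) :
    (rayleighValues p κ univ).Nonempty := by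
  have := isFiniteMeasure_weight hκ univ
  set g : ℝ → ℝ := (Ioo (-1) 1).indicator fun _ => 1 with hg
  have hgm : Measurable g := measurable_const.indicator measurableSet_Ioo
  have hLp : MemLp g (ENNReal.ofReal p) (weight κ univ) :=
    MemLp.of_bound hgm.aestronglyMeasurable 1 (Filter.Eventually.of_forall fun t => by
      by_cases ht : t ∈ Ioo (-1 : ℝ) 1 <;> simp [hg, ht])
  obtain ⟨hi, hS, h0⟩ := isSobolev_odd_primitive (b := 1) hp hκ (g := g) (fun t => by
      have : -t ∈ Ioo (-1 : ℝ) 1 ↔ t ∈ Ioo (-1 : ℝ) 1 := by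
        simp only [mem_Ioo]; constructor <;> rintro ⟨_, _⟩ <;> constructor <;> linarith
      by_cases ht : t ∈ Ioo (-1 : ℝ) 1
      · simp [hg, ht, this.2 ht]
      · simp only [hg, indicator_of_notMem ht, indicator_of_notMem (mt this.1 ht)]) hLp (fun t ht => by
      refine indicator_of_notMem (fun h => ?_) _
      rw [mem_Ioo, ← abs_lt] at h
      linarith)
  refine ⟨_, _, g, hS, fun hz => ?_, h0, rfl⟩
  have hz' : ∀ᵐ t : ℝ, t ∈ Ioo (0 : ℝ) 1 → False := by
    have h1 := (restrict_absolutelyContinuous_weight κ univ).ae_le hz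
    rw [Measure.restrict_univ] at h1
    filter_upwards [h1] with t ht htm
    have : ∫ x in (0 : ℝ)..t, g x = t := by
      rw [intervalIntegral.integral_congr (g := fun _ => (1 : ℝ))]
      · simp
      · intro x hx
        rw [uIcc_of_le htm.1.le] at hx
        exact indicator_of_mem (show x ∈ Ioo (-1 : ℝ) 1 from
          ⟨by linarith [hx.1], hx.2.trans_lt htm.2⟩) _
    rw [this] at ht
    exact htm.1.ne' ht
  have h2 := ae_iff.1 hz'
  have h3 : {a : ℝ | ¬(a ∈ Ioo (0 : ℝ) 1 → False)} = Ioo 0 1 := by ext; simp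
  rw [h3, Real.volume_Ioo] at h2
  simp at h2

/-- Extend `g` by zero beyond `b` and evenly to the line; the odd primitive is a competitor for
`lambdaZero`, and both of its integrals fold to twice half-line integrals. Dropping the part beyond
`b` on the left only weakens the inequality. -/
theorem halfIneq_lambdaZero {p κ b : ℝ} (hp : 1 < p) (hκ : 0 < κ) :
    HalfIneq p κ (lambdaZero p κ) (Ioo 0 b) := by
  have hp0 : 0 < p := by linarith
  intro g hg
  by_cases hT : ∫⁻ t in Ioo 0 b, g t ^ p * ENNReal.ofReal (rho κ t) = ⊤
  · rw [hT]; exact le_top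
  -- Taking real values loses nothing: finiteness of the right side, assumed by now, makes `g`
  -- finite almost everywhere on `(0, b)`.
  set gr : ℝ → ℝ := fun t => (Ioo 0 b).indicator (fun x => (g x).toReal) |t| with hgr
  have hgrm : Measurable gr :=
    (hg.ennreal_toReal.indicator measurableSet_Ioo).comp measurable_abs
  have hgr0 : ∀ t, 0 ≤ gr t := fun t =>
    indicator_nonneg (fun x _ => ENNReal.toReal_nonneg) _
  have hfin : ∀ᵐ t, t ∈ Ioo 0 b → ‖gr t‖ₑ = g t := by
    have h1 := ae_lt_top ((hg.pow_const p).mul (measurable_ofReal_rho κ)) hT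
    filter_upwards [(ae_restrict_iff' measurableSet_Ioo).1 h1] with t ht htm
    have h2 : g t ≠ ⊤ := by
      intro h
      have := ht htm
      rw [Pi.mul_apply, h, ENNReal.top_rpow_of_pos hp0, ENNReal.top_mul (by simp [rho_pos])] at this
      exact lt_irrefl _ this
    rw [hgr]
    simp only [abs_of_pos htm.1, indicator_of_mem htm]
    rw [Real.enorm_eq_ofReal ENNReal.toReal_nonneg, ENNReal.ofReal_toReal h2]
  have hzero : ∀ t, b ≤ |t| → gr t = 0 := fun t ht =>
    indicator_of_notMem (fun h => absurd h.2 (not_lt.2 ht)) _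
  have hev : ∀ t, gr (-t) = gr t := fun t => by simp only [hgr, abs_neg]
  have hnorm : ∫⁻ t, ‖gr t‖ₑ ^ p ∂(weight κ univ)
      = 2 * ∫⁻ t in Ioo 0 b, g t ^ p * ENNReal.ofReal (rho κ t) := by
    rw [lintegral_weight, setLIntegral_eq_add_reflect fun x _ => mem_univ (-x)]
    simp only [hev, rho_neg]
    rw [← two_mul, univ_inter]
    congr 1
    have : ∀ t ∈ Ioi (0 : ℝ), ‖gr t‖ₑ ^ p * ENNReal.ofReal (rho κ t)
        = (Ioo 0 b).indicator (fun t => ‖gr t‖ₑ ^ p * ENNReal.ofReal (rho κ t)) t := by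
      intro t ht
      by_cases htm : t ∈ Ioo 0 b
      · rw [indicator_of_mem htm]
      · rw [indicator_of_notMem htm, hzero t, enorm_zero, ENNReal.zero_rpow_of_pos hp0, zero_mul]
        rw [abs_of_pos ht]
        by_contra hn
        exact htm ⟨ht, not_le.1 hn⟩
    rw [setLIntegral_congr_fun measurableSet_Ioi this, setLIntegral_indicator measurableSet_Ioo,
      inter_eq_left.2 (fun x hx => hx.1)]
    refine setLIntegral_congr_fun_ae measurableSet_Ioo ?_
    filter_upwards [hfin] with t ht htm
    rw [ht htm]
  have hLp : MemLp gr (ENNReal.ofReal p) (weight κ univ) := by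
    refine ⟨hgrm.aestronglyMeasurable, ?_⟩
    rw [eLpNorm_lt_top_iff_lintegral_rpow_enorm_lt_top (by simpa using hp0) ENNReal.ofReal_ne_top,
      ENNReal.toReal_ofReal hp0.le, hnorm]
    exact ENNReal.mul_lt_top (by simp) (lt_top_iff_ne_top.2 hT)
  obtain ⟨hi, hS, h0⟩ := isSobolev_odd_primitive hp hκ hev hLp hzero
  have key := lambdaZero_mul_lintegral_le hp hS h0
  rw [hnorm] at key
  have hΦ : ∀ t ∈ Ioo 0 b, ‖∫ x in (0 : ℝ)..t, gr x‖ₑ = ∫⁻ s in Ioo 0 t, g s := by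
    intro t ht
    rw [intervalIntegral.integral_of_le ht.1.le, integral_Ioc_eq_integral_Ioo,
      Real.enorm_eq_ofReal (integral_nonneg hgr0),
      ofReal_integral_eq_lintegral_ofReal hi.integrableOn (Filter.Eventually.of_forall hgr0)]
    refine setLIntegral_congr_fun_ae measurableSet_Ioo ?_
    filter_upwards [hfin] with s hs hsm
    rw [← hs ⟨hsm.1, hsm.2.trans ht.2⟩, Real.enorm_eq_ofReal (hgr0 s)]
  have hodd := primitive_neg_of_even hev
  have hlow : 2 * ∫⁻ t in Ioo 0 b, (∫⁻ s in Ioo 0 t, g s) ^ p * ENNReal.ofReal (rho κ t)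
      ≤ ∫⁻ t, ‖∫ x in (0 : ℝ)..t, gr x‖ₑ ^ p ∂(weight κ univ) := by
    rw [lintegral_weight, setLIntegral_eq_add_reflect fun x _ => mem_univ (-x)]
    simp only [hodd, rho_neg, enorm_neg]
    rw [← two_mul, univ_inter]
    refine mul_le_mul_right ?_ _
    refine le_trans (le_of_eq ?_) (lintegral_mono_set (fun x hx => hx.1 : Ioo 0 b ⊆ Ioi 0))
    refine setLIntegral_congr_fun measurableSet_Ioo fun t ht => ?_
    simp only [hΦ t ht]
  have h2 := (mul_le_mul_right hlow (ENNReal.ofReal (lambdaZero p κ))).trans key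
  rw [mul_left_comm] at h2
  exact (ENNReal.mul_le_mul_iff_right (by simp) (by simp)).1 h2

/-! ### Integral identities for solutions -/

/-- `w` solves the equation with parameter `lam` inside `[c, d]`, and `u` is its derivative. -/
structure SolvesOn (p κ lam c d : ℝ) (w u : ℝ → ℝ) : Prop where
  cont : ContinuousOn w (Icc c d)
  cont_deriv : ContinuousOn u (Icc c d)
  hasDerivAt : ∀ t ∈ Ioo c d, HasDerivAt w (u t) t
  hasDerivAt_flux : ∀ t ∈ Ioo c d, HasDerivAt (fun x => oddPow p (u x))
    (κ * t * oddPow p (u t) - lam * oddPow p (w t)) t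

namespace SolvesOn

variable {p κ lam c d : ℝ} {w u : ℝ → ℝ}

theorem mono (h : SolvesOn p κ lam c d w u) {c' d' : ℝ} (hc : c ≤ c') (hd : d' ≤ d) :
    SolvesOn p κ lam c' d' w u :=
  ⟨h.cont.mono (Icc_subset_Icc hc hd), h.cont_deriv.mono (Icc_subset_Icc hc hd),
    fun t ht => h.hasDerivAt t (Ioo_subset_Ioo hc hd ht),
    fun t ht => h.hasDerivAt_flux t (Ioo_subset_Ioo hc hd ht)⟩

theorem integral_deriv (h : SolvesOn p κ lam c d w u) (hcd : c ≤ d) :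
    ∫ t in c..d, u t = w d - w c :=
  intervalIntegral.integral_eq_sub_of_hasDerivAt_of_le hcd h.cont h.hasDerivAt
    (h.cont_deriv.intervalIntegrable_of_Icc hcd)

/-- The weight is the integrating factor: `(ρ |w'|^(p-2) w')' = -lam ρ |w|^(p-2) w`. -/
theorem integral_oddPow (hp : 1 < p) (h : SolvesOn p κ lam c d w u) (hcd : c ≤ d) :
    ∫ t in c..d, lam * (oddPow p (w t) * rho κ t)
      = rho κ c * oddPow p (u c) - rho κ d * oddPow p (u d) := by
  have hρ := continuous_rho κ
  have hV : ContinuousOn (fun t => oddPow p (u t)) (Icc c d) :=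
    (continuous_oddPow hp).comp_continuousOn h.cont_deriv
  have hW : ContinuousOn (fun t => oddPow p (w t)) (Icc c d) :=
    (continuous_oddPow hp).comp_continuousOn h.cont
  have := intervalIntegral.integral_eq_sub_of_hasDerivAt_of_le hcd
    (f := fun t => -(rho κ t * oddPow p (u t))) (f' := fun t => lam * (oddPow p (w t) * rho κ t))
    (hρ.continuousOn.mul hV).neg
    (fun t ht => (((hasDerivAt_rho κ t).mul (h.hasDerivAt_flux t ht)).neg).congr_deriv (by ring))
    ((continuousOn_const.mul (hW.mul hρ.continuousOn)).intervalIntegrable_of_Icc hcd)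
  rw [this]; ring

theorem integral_energy (hp : 1 < p) (h : SolvesOn p κ lam c d w u) (hcd : c ≤ d) :
    (∫ t in c..d, |u t| ^ p * rho κ t) - lam * ∫ t in c..d, |w t| ^ p * rho κ t
      = rho κ d * oddPow p (u d) * w d - rho κ c * oddPow p (u c) * w c := by
  have hp0 : 0 ≤ p := by linarith
  have hρ := (continuous_rho κ).continuousOn (s := Icc c d)
  have hV : ContinuousOn (fun t => oddPow p (u t)) (Icc c d) :=
    (continuous_oddPow hp).comp_continuousOn h.cont_deriv
  have h1 : ContinuousOn (fun t => |u t| ^ p * rho κ t) (Icc c d) :=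
    (h.cont_deriv.abs.rpow_const fun _ _ => Or.inr hp0).mul hρ
  have h2 : ContinuousOn (fun t => |w t| ^ p * rho κ t) (Icc c d) :=
    (h.cont.abs.rpow_const fun _ _ => Or.inr hp0).mul hρ
  rw [← intervalIntegral.integral_const_mul, ← intervalIntegral.integral_sub
    (h1.intervalIntegrable_of_Icc hcd) ((h2.intervalIntegrable_of_Icc hcd).const_mul lam)]
  refine intervalIntegral.integral_eq_sub_of_hasDerivAt_of_le hcd
    (f := fun t => rho κ t * oddPow p (u t) * w t) ((hρ.mul hV).mul h.cont) (fun t ht => ?_)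
    ((h1.sub (continuousOn_const.mul h2)).intervalIntegrable_of_Icc hcd)
  refine ((((hasDerivAt_rho κ t).mul (h.hasDerivAt_flux t ht))).mul
    (h.hasDerivAt t ht)).congr_deriv ?_
  rw [← oddPow_mul_self hp, ← oddPow_mul_self hp, Pi.mul_apply]; ring

/-- The solution is its own test function in `halfIneq_of_test`, with `h = u`. The required bound is
`integral_oddPow` on `[s, a]`, where the boundary term at `a` has the favourable sign because `u a ≥
0`. -/
theorem halfIneq {a : ℝ} (hp : 1 < p) (hlam : 0 < lam) (h : SolvesOn p κ lam 0 a w u)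
    (hwc : Continuous w) (huc : Continuous u) (hw0 : w 0 = 0) (hu : ∀ t ∈ Ioo 0 a, 0 < u t)
    (ha : 0 ≤ u a) : HalfIneq p κ lam (Ioo 0 a) := by
  have hint : ∀ t ∈ Icc 0 a, ∫ s in (0 : ℝ)..t, u s = w t := by
    intro t ht
    rw [(h.mono le_rfl ht.2).integral_deriv ht.1, hw0, sub_zero]
  have hw : ∀ t ∈ Icc 0 a, 0 ≤ w t := by
    intro t ht
    rw [← hint t ht, intervalIntegral.integral_of_le ht.1, integral_Ioc_eq_integral_Ioo]
    exact setIntegral_nonneg measurableSet_Ioo fun s hs => (hu s ⟨hs.1, hs.2.trans_le ht.2⟩).le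
  refine halfIneq_of_test hp huc.measurable hwc.measurable hu (fun t ht => ?_) (fun s hs => ?_)
  · rw [← hint t (Ioo_subset_Icc_self ht), intervalIntegral.integral_of_le ht.1.le,
      integral_Ioc_eq_integral_Ioo, ofReal_integral_eq_lintegral_ofReal]
    · exact huc.integrableOn_Icc.mono_set Ioo_subset_Icc_self
    · exact (ae_restrict_iff' measurableSet_Ioo).2 (Filter.Eventually.of_forall
        fun x hx => (hu x ⟨hx.1, hx.2.trans ht.2⟩).le)
  · have e1 : ∫⁻ t in Ioo s a, ENNReal.ofReal (w t) ^ (p - 1) * ENNReal.ofReal (rho κ t)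
        = ENNReal.ofReal (∫ t in s..a, oddPow p (w t) * rho κ t) := by
      have hcont : Continuous fun t => oddPow p (w t) * rho κ t :=
        ((continuous_oddPow hp).comp hwc).mul (continuous_rho κ)
      have hnn : ∀ t ∈ Ioo s a, 0 ≤ w t := fun t ht => hw t ⟨(hs.1.trans ht.1).le, ht.2.le⟩
      rw [intervalIntegral.integral_of_le hs.2.le, integral_Ioc_eq_integral_Ioo,
        ofReal_integral_eq_lintegral_ofReal]
      · refine setLIntegral_congr_fun measurableSet_Ioo fun t ht => ?_
        rw [oddPow_of_nonneg hp (hnn t ht),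
          ENNReal.ofReal_mul (Real.rpow_nonneg (hnn t ht) _),
          ENNReal.ofReal_rpow_of_nonneg (hnn t ht) (by linarith)]
      · exact hcont.integrableOn_Icc.mono_set Ioo_subset_Icc_self
      · refine (ae_restrict_iff' measurableSet_Ioo).2 (Filter.Eventually.of_forall fun x hx => ?_)
        simp only [Pi.zero_apply]
        rw [oddPow_of_nonneg hp (hnn x hx)]
        exact mul_nonneg (Real.rpow_nonneg (hnn x hx) _) (rho_pos κ x).le
    have hus := (hu s hs).le
    rw [e1, ← ENNReal.ofReal_mul hlam.le, ← intervalIntegral.integral_const_mul,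
      (h.mono hs.1.le le_rfl).integral_oddPow hp hs.2.le,
      ENNReal.ofReal_rpow_of_nonneg hus (by linarith),
      ← ENNReal.ofReal_mul (Real.rpow_nonneg hus _), oddPow_of_nonneg hp hus,
      oddPow_of_nonneg hp ha]
    apply ENNReal.ofReal_le_ofReal
    have : 0 ≤ rho κ a * u a ^ (p - 1) := mul_nonneg (rho_pos κ a).le (Real.rpow_nonneg ha _)
    linarith

/-- With `g = u` and vanishing boundary terms, the energy identity gives `∫ |u|^p ρ = lam ∫ |w|^p
ρ`, so no larger constant can be admissible. -/
theorem le_of_halfIneq {a L : ℝ} (hp : 1 < p) (hlam : 0 < lam) (ha0 : 0 < a)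
    (h : SolvesOn p κ lam 0 a w u)
    (hwc : Continuous w) (huc : Continuous u) (hw0 : w 0 = 0) (hu : ∀ t ∈ Ioo 0 a, 0 < u t)
    (ha : u a = 0) (hL : HalfIneq p κ L (Ioo 0 a)) : L ≤ lam := by
  rcases le_or_gt L 0 with hL0 | hL0
  · linarith
  have hp0 : 0 < p := by linarith
  have hint : ∀ t ∈ Icc 0 a, ∫ s in (0 : ℝ)..t, u s = w t := by
    intro t ht
    rw [(h.mono le_rfl ht.2).integral_deriv ht.1, hw0, sub_zero]
  have hwpos : ∀ t ∈ Ioo 0 a, 0 < w t := by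
    intro t ht
    rw [← hint t (Ioo_subset_Icc_self ht)]
    exact intervalIntegral.intervalIntegral_pos_of_pos_on (huc.intervalIntegrable _ _)
      (fun x hx => hu x ⟨hx.1, hx.2.trans ht.2⟩) ht.1
  have conv : ∀ f : ℝ → ℝ, Continuous f → (∀ t ∈ Ioo 0 a, 0 < f t) →
      ∫⁻ t in Ioo 0 a, ENNReal.ofReal (f t) ^ p * ENNReal.ofReal (rho κ t)
        = ENNReal.ofReal (∫ t in (0 : ℝ)..a, |f t| ^ p * rho κ t) := by
    intro f hf hf0
    have hc : Continuous fun t => |f t| ^ p * rho κ t :=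
      (hf.abs.rpow_const fun _ => Or.inr hp0.le).mul (continuous_rho κ)
    rw [intervalIntegral.integral_of_le ha0.le, integral_Ioc_eq_integral_Ioo,
        ofReal_integral_eq_lintegral_ofReal (hc.integrableOn_Icc.mono_set Ioo_subset_Icc_self)
        (Filter.Eventually.of_forall fun t => mul_nonneg (by positivity) (rho_pos κ t).le)]
    refine setLIntegral_congr_fun measurableSet_Ioo fun t ht => ?_
    rw [ENNReal.ofReal_mul (by positivity), abs_of_pos (hf0 t ht),
      ENNReal.ofReal_rpow_of_nonneg (hf0 t ht).le hp0.le]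
  have key := hL (fun t => ENNReal.ofReal (u t)) huc.measurable.ennreal_ofReal
  have e : ∫⁻ t in Ioo 0 a, (∫⁻ s in Ioo 0 t, ENNReal.ofReal (u s)) ^ p * ENNReal.ofReal (rho κ t)
      = ∫⁻ t in Ioo 0 a, ENNReal.ofReal (w t) ^ p * ENNReal.ofReal (rho κ t) := by
    refine setLIntegral_congr_fun measurableSet_Ioo fun t ht => ?_
    rw [← hint t (Ioo_subset_Icc_self ht), intervalIntegral.integral_of_le ht.1.le,
      integral_Ioc_eq_integral_Ioo, ofReal_integral_eq_lintegral_ofReal]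
    · exact huc.integrableOn_Icc.mono_set Ioo_subset_Icc_self
    · exact (ae_restrict_iff' measurableSet_Ioo).2 (Filter.Eventually.of_forall
        fun x hx => (hu x ⟨hx.1, hx.2.trans ht.2⟩).le)
  have hcw : Continuous fun t => |w t| ^ p * rho κ t :=
    (hwc.abs.rpow_const fun _ => Or.inr hp0.le).mul (continuous_rho κ)
  have hX : 0 < ∫ t in (0 : ℝ)..a, |w t| ^ p * rho κ t :=
    intervalIntegral.intervalIntegral_pos_of_pos_on (hcw.intervalIntegrable _ _)
      (fun x hx => mul_pos (Real.rpow_pos_of_pos (abs_pos.2 (hwpos x hx).ne') _) (rho_pos κ x)) ha0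
  have hen := h.integral_energy hp ha0.le
  rw [ha, hw0, oddPow_zero] at hen
  have hen' : ∫ t in (0 : ℝ)..a, |u t| ^ p * rho κ t
      = lam * ∫ t in (0 : ℝ)..a, |w t| ^ p * rho κ t := by linarith
  rw [e, conv w hwc hwpos, conv u huc hu, hen', ← ENNReal.ofReal_mul hL0.le,
    ENNReal.ofReal_le_ofReal_iff (by positivity)] at key
  exact le_of_mul_le_mul_right key hX

end SolvesOn

theorem IsSolutionOn.solvesOn {p κ lam c d : ℝ} {w : ℝ → ℝ} (hcd : c < d)
    (h : IsSolutionOn p κ lam (Icc c d) w) :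
    SolvesOn p κ lam c d w (derivWithin w (Icc c d)) := by
  have hU := uniqueDiffOn_Icc hcd
  refine ⟨h.contDiffOn.continuousOn, h.contDiffOn.continuousOn_derivWithin hU le_rfl,
    fun t ht => ?_, fun t ht => ?_⟩
  · exact ((h.contDiffOn.differentiableOn (by simp) t
      (Ioo_subset_Icc_self ht)).hasDerivWithinAt).hasDerivAt (Icc_mem_nhds ht.1 ht.2)
  · have h1 := ((h.contDiffOn_flux.differentiableOn (by simp) t
      (Ioo_subset_Icc_self ht)).hasDerivWithinAt).hasDerivAt (Icc_mem_nhds ht.1 ht.2)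
    exact h1.congr_deriv (by linarith [h.equation t (Ioo_subset_Icc_self ht)])

/-- The eigenfunction is the competitor. Integrating the equation gives `μ` times the constraint
integral equal to zero, which is why `μ ≠ 0` is needed; multiplying the equation by `w` first gives
the quotient. -/
theorem IsNeumannEigenvalue.mem_rayleighValues {p κ δ μ : ℝ} (hp : 1 < p) (hκ : 0 < κ)
    (hδ : 0 < δ) (hμ : μ ≠ 0) (h : IsNeumannEigenvalue p κ δ μ) :
    μ ∈ rayleighValues p κ (Ioo (-(δ / 2)) (δ / 2)) := by
  obtain ⟨w, hw, ⟨t₀, ht₀, hwt₀⟩, hl, hr⟩ := h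
  set a := δ / 2 with ha
  have ha0 : 0 < a := by positivity
  have haa : -a < a := by linarith
  have hp0 : 0 < p := by linarith
  have hS := hw.solvesOn haa
  set u := derivWithin w (Icc (-a) a) with hu
  have hfin := isFiniteMeasure_weight hκ (Ioo (-a) a)
  have hmem : ∀ f : ℝ → ℝ, ContinuousOn f (Icc (-a) a) →
      MemLp f (ENNReal.ofReal p) (weight κ (Ioo (-a) a)) := by
    intro f hf
    obtain ⟨C, hC⟩ := isCompact_Icc.exists_bound_of_continuousOn hf
    refine MemLp.of_bound (((hf.mono Ioo_subset_Icc_self).aestronglyMeasurable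
      measurableSet_Ioo).mono_ac (weight_absolutelyContinuous κ _)) C ?_
    exact (weight_absolutelyContinuous κ _).ae_le ((ae_restrict_iff' measurableSet_Ioo).2
      (Filter.Eventually.of_forall fun x hx => hC x (Ioo_subset_Icc_self hx)))
  have hconv : ∀ f : ℝ → ℝ, ∫ t, f t ∂(weight κ (Ioo (-a) a)) = ∫ t in (-a)..a, f t * rho κ t := by
    intro f
    rw [integral_weight, intervalIntegral.integral_of_le haa.le, integral_Ioc_eq_integral_Ioo]
  have hne : ¬ w =ᵐ[weight κ (Ioo (-a) a)] 0 := by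
    intro hz
    have h1 : w =ᵐ[volume.restrict (Icc (-a) a)] 0 := by
      rw [← restrict_Ioo_eq_restrict_Icc]
      exact (restrict_absolutelyContinuous_weight κ _).ae_le hz
    exact hwt₀ (Measure.eqOn_Icc_of_ae_eq volume haa.ne h1 hS.cont continuousOn_const ht₀)
  refine ⟨w, u, isSobolev_of_primitive hp hκ isOpen_Ioo ordConnected_Ioo ⟨by linarith, ha0⟩
    (hmem w hS.cont) (hmem u hS.cont_deriv) (C := w 0) fun t ht => ?_, hne, ?_, ?_⟩
  · have key : ∀ x ∈ Ioo (-a) a, ∫ s in (-a)..x, u s = w x - w (-a) := fun x hx =>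
      (hS.mono le_rfl hx.2.le).integral_deriv hx.1.le
    have hii : ∀ x ∈ Ioo (-a) a, IntervalIntegrable u volume (-a) x := fun x hx =>
      (hS.mono le_rfl hx.2.le).cont_deriv.intervalIntegrable_of_Icc hx.1.le
    have h0 : (0 : ℝ) ∈ Ioo (-a) a := ⟨by linarith, ha0⟩
    rw [← intervalIntegral.integral_interval_sub_left (hii t ht) (hii 0 h0), key t ht, key 0 h0]
    ring
  · have := hS.integral_oddPow hp haa.le
    rw [hl, hr, oddPow_zero, intervalIntegral.integral_const_mul] at this
    rw [hconv]
    have h2 : μ * ∫ t in (-a)..a, oddPow p (w t) * rho κ t = 0 := by linarith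
    exact (mul_eq_zero.1 h2).resolve_left hμ
  · have hX := integral_rpow_abs_pos hp (hmem w hS.cont) hne
    rw [eq_div_iff hX.ne', hconv, hconv]
    have := hS.integral_energy hp haa.le
    rw [hl, hr, oddPow_zero] at this
    linarith

/-! ### Global existence of solutions -/

theorem exists_hasDerivWithinAt_Icc {c d : ℝ} (hcd : c ≤ d) {h : ℝ → ℝ}
    (hh : ContinuousOn h (Icc c d)) :
    ∃ B : ℝ → ℝ, B c = 0 ∧ ∀ t ∈ Icc c d, HasDerivWithinAt B (h t) (Icc c d) t := by
  set e := IccExtend hcd ((Icc c d).domRestrict h) with he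
  have hc : Continuous e := (continuousOn_iff_continuous_domRestrict.1 hh).Icc_extend'
  refine ⟨fun t => ∫ x in c..t, e x, by simp, fun t ht => ?_⟩
  have h1 : HasDerivAt (fun t => ∫ x in c..t, e x) (e t) t :=
    intervalIntegral.integral_hasDerivAt_right (hc.intervalIntegrable _ _)
      (hc.stronglyMeasurableAtFilter _ _) hc.continuousAt
  have h2 : e t = h t := by rw [he, IccExtend_of_mem _ _ ht]; rfl
  rw [h2] at h1
  exact h1.hasDerivWithinAt

/-- For `r > 1` the field is `C¹` in `y`, so Picard–Lindelöf applies. The time step `τ` is uniform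
in the starting time `c ∈ [0, N]` and in the datum `|y₀| ≤ 1`. -/
theorem exists_riccati_solution (α β γ : ℝ) {r N : ℝ} (hr : 1 < r) (hN : 0 ≤ N) :
    ∃ τ, 0 < τ ∧ ∀ c d y₀ : ℝ, 0 ≤ c → c ≤ N → c ≤ d → d ≤ c + τ → |y₀| ≤ 1 →
      ∃ y : ℝ → ℝ, y c = y₀ ∧ ∀ t ∈ Icc c d,
        HasDerivWithinAt y (α + β * t * y t + γ * |y t| ^ r) (Icc c d) t := by
  have hr0 : 0 ≤ r := by linarith
  -- `M` bounds the field and `K` its Lipschitz constant for `|t| ≤ N + 1` and `|y| ≤ 2`, a region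
  -- containing the unit ball about `y₀`.
  set M : ℝ := |α| + |β| * (N + 1) * 2 + |γ| * 2 ^ r with hM
  set K : ℝ := |β| * (N + 1) + |γ| * (r * 2 ^ (r - 1)) with hK
  have hM0 : 0 ≤ M := by positivity
  have hK0 : 0 ≤ K := by positivity
  refine ⟨min 1 (1 / (M + 1)), by positivity, fun c d y₀ hc hcN hcd hd hy => ?_⟩
  have hd1 : d ≤ c + 1 := hd.trans (by gcongr; exact min_le_left _ _)
  have hd2 : d - c ≤ 1 / (M + 1) := by
    have := min_le_right 1 (1 / (M + 1)); linarith
  have hball : ∀ y ∈ Metric.closedBall y₀ ((1 : NNReal) : ℝ), |y| ≤ 2 := by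
    intro y hy'
    rw [Metric.mem_closedBall, Real.dist_eq, NNReal.coe_one] at hy'
    calc |y| = |(y - y₀) + y₀| := by ring_nf
      _ ≤ |y - y₀| + |y₀| := abs_add_le _ _
      _ ≤ 2 := by linarith
  have ht' : ∀ t ∈ Icc c d, |t| ≤ N + 1 := fun t ht => by
    rw [abs_of_nonneg (hc.trans ht.1)]; linarith [ht.2]
  have hPL : IsPicardLindelof (fun t y => α + β * t * y + γ * |y| ^ r)
      (⟨c, left_mem_Icc.2 hcd⟩ : Icc c d) y₀ 1 0 (.mk M hM0) (.mk K hK0) := by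
    refine ⟨fun t ht => ?_, fun y _ => by fun_prop, fun t ht y hy' => ?_, ?_⟩
    · refine (convex_closedBall _ _).lipschitzOnWith_of_nnnorm_hasDerivWithin_le
        (f' := fun y => β * t + γ * (r * oddPow r y)) (fun y _ => ?_) fun y hy' => ?_
      · have := ((hasDerivAt_const y α).add ((hasDerivAt_id y).const_mul (β * t))).add
          ((hasDerivAt_abs_rpow_oddPow hr y).const_mul γ)
        exact (this.congr_deriv (by ring)).hasDerivWithinAt
      · rw [← NNReal.coe_le_coe, coe_nnnorm, Real.norm_eq_abs, NNReal.coe_mk]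
        refine (abs_add_le _ _).trans (add_le_add ?_ ?_)
        · rw [abs_mul]; gcongr; exact ht' t ht
        · rw [abs_mul, abs_mul, abs_oddPow hr, abs_of_nonneg hr0]
          gcongr
          exact hball y hy'
    · rw [Real.norm_eq_abs, NNReal.coe_mk]
      refine (abs_add_le _ _).trans (add_le_add ((abs_add_le _ _).trans (add_le_add le_rfl ?_)) ?_)
      · rw [abs_mul, abs_mul]
        gcongr
        · exact ht' t ht
        · exact hball y hy'
      · rw [abs_mul, abs_of_nonneg (Real.rpow_nonneg (abs_nonneg y) r)]
        gcongr
        exact hball y hy'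
    · simp only [sub_self, NNReal.coe_mk, NNReal.coe_one, NNReal.coe_zero, sub_zero]
      rw [max_eq_left (by linarith)]
      calc M * (d - c) ≤ M * (1 / (M + 1)) := by gcongr
        _ ≤ 1 := by rw [mul_one_div, div_le_one (by linarith)]; linarith
  exact hPL.exists_eq_forall_mem_Icc_hasDerivWithinAt₀

/-- `w` and its flux `v` solve the equation, written as a first order system, on `[c, d]`. -/
def IsFlow (p κ lam c d : ℝ) (w v : ℝ → ℝ) : Prop :=
  ∀ t ∈ Icc c d, HasDerivWithinAt w (oddPow (conjExp p) (v t)) (Icc c d) t ∧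
    HasDerivWithinAt v (κ * t * v t - lam * oddPow p (w t)) (Icc c d) t

theorem IsFlow.congr {p κ lam c d : ℝ} {w v w' v' : ℝ → ℝ} (h : IsFlow p κ lam c d w v)
    (hw : EqOn w' w (Icc c d)) (hv : EqOn v' v (Icc c d)) : IsFlow p κ lam c d w' v' := by
  intro t ht
  rw [hw ht, hv ht]
  exact ⟨(h t ht).1.congr hw (hw ht), (h t ht).2.congr hv (hv ht)⟩

theorem IsFlow.union {p κ lam c d e : ℝ} {w v : ℝ → ℝ} (hcd : c ≤ d) (hde : d ≤ e)
    (h₁ : IsFlow p κ lam c d w v) (h₂ : IsFlow p κ lam d e w v) : IsFlow p κ lam c e w v := by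
  intro t _
  rw [← Icc_union_Icc_eq_Icc hcd hde]
  have key : ∀ (x y : ℝ) (f : ℝ → ℝ) (f' : ℝ), t ∉ Icc x y → HasDerivWithinAt f f' (Icc x y) t :=
    fun x y f f' ht => HasFDerivWithinAt.of_notMem_closure (by rwa [isClosed_Icc.closure_eq])
  constructor
  · refine HasDerivWithinAt.union ?_ ?_
    · by_cases ht : t ∈ Icc c d
      · exact (h₁ t ht).1
      · exact key _ _ _ _ ht
    · by_cases ht : t ∈ Icc d e
      · exact (h₂ t ht).1
      · exact key _ _ _ _ ht
  · refine HasDerivWithinAt.union ?_ ?_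
    · by_cases ht : t ∈ Icc c d
      · exact (h₁ t ht).2
      · exact key _ _ _ _ ht
    · by_cases ht : t ∈ Icc d e
      · exact (h₂ t ht).2
      · exact key _ _ _ _ ht

theorem IsFlow.neg {p κ lam c d : ℝ} {w v : ℝ → ℝ} (h : IsFlow p κ lam c d w v) :
    IsFlow p κ lam (-d) (-c) (fun t => -w (-t)) (fun t => v (-t)) := by
  intro t ht
  have ht' : -t ∈ Icc c d := ⟨by linarith [ht.2], by linarith [ht.1]⟩
  have hm : MapsTo (fun t : ℝ => -t) (Icc (-d) (-c)) (Icc c d) :=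
    fun x hx => ⟨by linarith [hx.2], by linarith [hx.1]⟩
  have hn : HasDerivWithinAt (fun t : ℝ => -t) (-1) (Icc (-d) (-c)) t :=
    (hasDerivAt_neg t).hasDerivWithinAt
  refine ⟨?_, ?_⟩
  · exact (((h (-t) ht').1.comp t hn hm).neg).congr_deriv (by ring)
  · exact ((h (-t) ht').2.comp t hn hm).congr_deriv (by rw [oddPow_neg]; ring)

/-- From every nonzero state at time `c` there is a flow on `[c, d]` ending in a nonzero state. -/
def HasFlows (p κ lam c d : ℝ) : Prop :=
  ∀ z : ℝ × ℝ, z ≠ 0 → ∃ w v : ℝ → ℝ, IsFlow p κ lam c d w v ∧ w c = z.1 ∧ v c = z.2 ∧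
    (w d, v d) ≠ 0

theorem HasFlows.trans {p κ lam c d e : ℝ} (hcd : c ≤ d) (hde : d ≤ e)
    (h₁ : HasFlows p κ lam c d) (h₂ : HasFlows p κ lam d e) : HasFlows p κ lam c e := by
  intro z hz
  obtain ⟨w₁, v₁, hf₁, hw₁, hv₁, hn₁⟩ := h₁ z hz
  obtain ⟨w₂, v₂, hf₂, hw₂, hv₂, hn₂⟩ := h₂ _ hn₁
  simp only at hw₂ hv₂
  set w : ℝ → ℝ := fun t => if t ≤ d then w₁ t else w₂ t with hw
  set v : ℝ → ℝ := fun t => if t ≤ d then v₁ t else v₂ t with hv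
  have ew : EqOn w w₂ (Icc d e) := fun t ht => by
    rcases ht.1.eq_or_lt with rfl | hlt
    · simp [hw, hw₂]
    · simp [hw, not_le.2 hlt]
  have ev : EqOn v v₂ (Icc d e) := fun t ht => by
    rcases ht.1.eq_or_lt with rfl | hlt
    · simp [hv, hv₂]
    · simp [hv, not_le.2 hlt]
  refine ⟨w, v, (hf₁.congr (fun t ht => ?_) fun t ht => ?_).union hcd hde (hf₂.congr ew ev),
    ?_, ?_, ?_⟩
  · simp [hw, ht.2]
  · simp [hv, ht.2]
  · simp [hw, hcd, hw₁]
  · simp [hv, hcd, hv₁]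
  · rwa [ew (right_mem_Icc.2 hde), ev (right_mem_Icc.2 hde)]

/-- The first order system need not be Lipschitz where `w` or the flux vanishes, but by homogeneity
a suitable quotient of the two solves a Riccati-type equation with `C¹` field. Choosing the larger
of the two as denominator bounds the initial quotient by `1`. -/
theorem exists_hasFlows_of_le {p κ lam N : ℝ} (hp : 1 < p) (hN : 0 ≤ N) :
    ∃ τ, 0 < τ ∧ ∀ c d : ℝ, 0 ≤ c → c ≤ N → c ≤ d → d ≤ c + τ → HasFlows p κ lam c d := by
  set q := conjExp p with hqdef
  have hq : 1 < q := one_lt_conjExp hp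
  have hp1 : p - 1 ≠ 0 := by linarith
  have hq1 : q - 1 = (p - 1)⁻¹ := conjExp_sub_one hp
  obtain ⟨τ₁, hτ₁, H₁⟩ := exists_riccati_solution 1 (-(κ * (q - 1))) (lam * (q - 1)) hp hN
  obtain ⟨τ₂, hτ₂, H₂⟩ := exists_riccati_solution (-lam) κ (-(p - 1)) hq hN
  refine ⟨min τ₁ τ₂, lt_min hτ₁ hτ₂, fun c d hc hcN hcd hd z hz => ?_⟩
  obtain ⟨w₀, v₀⟩ := z
  -- If the flux dominates, use `u = w / oddPow q v`, with `u' = 1 - κ(q-1) t u + lam (q-1) |u|^p`;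
  -- otherwise use `y = v / oddPow p w`, with `y' = -lam + κ t y - (p-1) |y|^q`.
  rcases le_or_gt |oddPow p w₀| |v₀| with hcase | hcase
  · have hv₀ : v₀ ≠ 0 := by
      rintro rfl
      rw [abs_zero] at hcase
      have := oddPow_eq_zero.1 (abs_eq_zero.1 (le_antisymm hcase (abs_nonneg _)))
      exact hz (by rw [this]; rfl)
    have hu₀ : |oddPow q (oddPow p w₀ / v₀)| ≤ 1 := by
      rw [abs_oddPow hq]
      refine Real.rpow_le_one (abs_nonneg _) ?_ (by linarith)
      rw [abs_div]
      exact div_le_one_of_le₀ hcase (abs_nonneg _)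
    obtain ⟨u, huc, hu⟩ := H₁ c d _ hc hcN hcd (hd.trans (by gcongr; exact min_le_left _ _)) hu₀
    have hucont : ContinuousOn u (Icc c d) := fun t ht => (hu t ht).continuousWithinAt
    obtain ⟨B, hB0, hB⟩ := exists_hasDerivWithinAt_Icc hcd
      (h := fun t => κ * t - lam * oddPow p (u t))
      (((continuous_const.mul continuous_id).continuousOn).sub
        (continuousOn_const.mul ((continuous_oddPow hp).comp_continuousOn hucont)))
    -- Once `u` is known, the flux satisfies a linear equation and is an exponential. It never
    -- vanishes, so the final state is nonzero and the construction can restart.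
    set V : ℝ → ℝ := fun t => v₀ * Real.exp (B t) with hV
    have hVne : ∀ t, V t ≠ 0 := fun t => mul_ne_zero hv₀ (Real.exp_pos _).ne'
    have hVd : ∀ t ∈ Icc c d,
        HasDerivWithinAt V ((κ * t - lam * oddPow p (u t)) * V t) (Icc c d) t := fun t ht =>
      ((hB t ht).exp.const_mul v₀).congr_deriv (by simp only [hV]; ring)
    refine ⟨fun t => u t * oddPow q (V t), V, fun t ht => ⟨?_, ?_⟩, ?_, ?_, ?_⟩
    · have h1 : HasDerivWithinAt (fun t => oddPow q (V t)) _ (Icc c d) t :=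
        (hasDerivAt_oddPow (p := q) (hVne t)).comp_hasDerivWithinAt t (hVd t ht)
      refine ((hu t ht).mul h1).congr_deriv ?_
      have e1 : |V t| ^ (q - 2) * V t = oddPow q (V t) := rfl
      have e2 := oddPow_mul_self hp (u t)
      have : u t * ((q - 1) * |V t| ^ (q - 2) * ((κ * t - lam * oddPow p (u t)) * V t))
          = (q - 1) * (κ * t * u t - lam * |u t| ^ p) * oddPow q (V t) := by
        rw [← e1, ← e2]; ring
      rw [this]
      ring
    · refine (hVd t ht).congr_deriv ?_
      rw [oddPow_mul, oddPow_oddPow_conjExp hp]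
      ring
    · simp only [hV, hB0, Real.exp_zero, mul_one, huc]
      rw [← oddPow_mul, div_mul_cancel₀ _ hv₀, oddPow_conjExp_oddPow hp]
    · simp [hV, hB0]
    · intro h
      exact hVne d (congrArg Prod.snd h)
  · have hw₀ : w₀ ≠ 0 := by
      rintro rfl
      rw [oddPow_zero, abs_zero] at hcase
      exact absurd hcase (not_lt.2 (abs_nonneg _))
    have hφ₀ : oddPow p w₀ ≠ 0 := mt oddPow_eq_zero.1 hw₀
    have hy₀ : |v₀ / oddPow p w₀| ≤ 1 := by
      rw [abs_div]
      exact div_le_one_of_le₀ hcase.le (abs_nonneg _)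
    obtain ⟨y, hyc, hy⟩ := H₂ c d _ hc hcN hcd (hd.trans (by gcongr; exact min_le_right _ _)) hy₀
    have hycont : ContinuousOn y (Icc c d) := fun t ht => (hy t ht).continuousWithinAt
    obtain ⟨B, hB0, hB⟩ := exists_hasDerivWithinAt_Icc hcd (h := fun t => oddPow q (y t))
      ((continuous_oddPow hq).comp_continuousOn hycont)
    set W : ℝ → ℝ := fun t => w₀ * Real.exp (B t) with hW
    have hWne : ∀ t, W t ≠ 0 := fun t => mul_ne_zero hw₀ (Real.exp_pos _).ne'
    have hWd : ∀ t ∈ Icc c d, HasDerivWithinAt W (oddPow q (y t) * W t) (Icc c d) t :=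
      fun t ht => ((hB t ht).exp.const_mul w₀).congr_deriv (by simp only [hW]; ring)
    refine ⟨W, fun t => y t * oddPow p (W t), fun t ht => ⟨?_, ?_⟩, ?_, ?_, ?_⟩
    · refine (hWd t ht).congr_deriv ?_
      rw [oddPow_mul, oddPow_conjExp_oddPow hp]
    · have h1 : HasDerivWithinAt (fun t => oddPow p (W t)) _ (Icc c d) t :=
        (hasDerivAt_oddPow (p := p) (hWne t)).comp_hasDerivWithinAt t (hWd t ht)
      refine ((hy t ht).mul h1).congr_deriv ?_
      have e1 : |W t| ^ (p - 2) * W t = oddPow p (W t) := rfl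
      have e2 := oddPow_mul_self hq (y t)
      have : y t * ((p - 1) * |W t| ^ (p - 2) * (oddPow q (y t) * W t))
          = (p - 1) * |y t| ^ q * oddPow p (W t) := by
        rw [← e1, ← e2]; ring
      rw [this]
      ring
    · simp [hW, hB0]
    · simp only [hW, hB0, Real.exp_zero, mul_one, hyc]
      rw [div_mul_cancel₀ _ hφ₀]
    · intro h
      exact hWne d (congrArg Prod.fst h)

/-- The step length depends only on the bound `d` for the starting times, so finitely many steps
reach `d`. -/
theorem hasFlows {p κ lam c d : ℝ} (hp : 1 < p) (hc : 0 ≤ c) (hcd : c ≤ d) :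
    HasFlows p κ lam c d := by
  obtain ⟨τ, hτ, H⟩ := exists_hasFlows_of_le (κ := κ) (lam := lam) hp (hc.trans hcd)
  have key : ∀ k : ℕ, ∀ c, 0 ≤ c → c ≤ d → d ≤ c + (k + 1) * τ → HasFlows p κ lam c d := by
    intro k
    induction k with
    | zero => intro c hc hcd h; exact H c d hc hcd hcd (by simpa using h)
    | succ k ih =>
      intro c hc hcd h
      rcases le_total d (c + τ) with h1 | h1
      · exact H c d hc hcd hcd h1
      · refine (H c (c + τ) hc hcd (by linarith) le_rfl).trans (by linarith) h1
          (ih (c + τ) (by linarith) h1 ?_)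
        push_cast at h
        linarith
  obtain ⟨k, hk⟩ := exists_nat_gt ((d - c) / τ)
  rw [div_lt_iff₀ hτ] at hk
  exact key k c hc hcd (by nlinarith)

theorem exists_isFlow_nonneg {p κ lam : ℝ} (hp : 1 < p) :
    ∃ w v : ℝ → ℝ, w 0 = 0 ∧ v 0 = 1 ∧ ∀ n : ℕ, IsFlow p κ lam 0 n w v := by
  have H : ∀ (n : ℕ) (z : {z : ℝ × ℝ // z ≠ 0}), ∃ f : (ℝ → ℝ) × (ℝ → ℝ),
      IsFlow p κ lam n (n + 1) f.1 f.2 ∧ f.1 n = z.1.1 ∧ f.2 n = z.1.2 ∧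
        (f.1 (n + 1), f.2 (n + 1)) ≠ 0 := by
    intro n z
    obtain ⟨w, v, h1, h2, h3, h4⟩ := hasFlows (κ := κ) (lam := lam) (c := n) (d := n + 1) hp
      (by positivity) (by linarith) z.1 z.2
    exact ⟨(w, v), h1, h2, h3, h4⟩
  choose f hf hw hv hne using H
  let z : ℕ → {z : ℝ × ℝ // z ≠ 0} := fun n =>
    Nat.rec ⟨(0, 1), by simp⟩ (fun n z => ⟨_, hne n z⟩) n
  have hz : ∀ n, (z (n + 1)).1 = ((f n (z n)).1 (n + 1), (f n (z n)).2 (n + 1)) := fun n => rfl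
  set w : ℝ → ℝ := fun t => (f ⌊t⌋₊ (z ⌊t⌋₊)).1 t with hwdef
  set v : ℝ → ℝ := fun t => (f ⌊t⌋₊ (z ⌊t⌋₊)).2 t with hvdef
  have hstep : ∀ n : ℕ, IsFlow p κ lam n (n + 1) w v := by
    intro n
    have hfl : ∀ t ∈ Icc (n : ℝ) (n + 1), t = n + 1 ∨ ⌊t⌋₊ = n := by
      intro t ht
      rcases ht.2.eq_or_lt with h | h
      · exact Or.inl h
      · exact Or.inr ((Nat.floor_eq_iff (by linarith [ht.1, n.cast_nonneg (α := ℝ)])).2 ⟨ht.1, h⟩)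
    have hn1 : ⌊(n : ℝ) + 1⌋₊ = n + 1 := by
      rw [Nat.floor_add_one (by positivity), Nat.floor_natCast]
    refine (hf n (z n)).congr (fun t ht => ?_) fun t ht => ?_
    · rcases hfl t ht with rfl | h
      · have := hw (n + 1) (z (n + 1))
        rw [hz] at this
        simp only [hwdef, hn1]
        push_cast at this
        exact this
      · simp only [hwdef, h]
    · rcases hfl t ht with rfl | h
      · have := hv (n + 1) (z (n + 1))
        rw [hz] at this
        simp only [hvdef, hn1]
        push_cast at this
        exact this
      · simp only [hvdef, h]
  refine ⟨w, v, ?_, ?_, fun n => ?_⟩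
  · have := hw 0 (z 0)
    simp only [hwdef, Nat.floor_zero]
    simpa [z] using this
  · have := hv 0 (z 0)
    simp only [hvdef, Nat.floor_zero]
    simpa [z] using this
  · induction n with
    | zero =>
      rw [Nat.cast_zero]
      intro t ht
      rw [Icc_self] at ht ⊢
      rw [mem_singleton_iff.1 ht]
      exact ⟨HasFDerivWithinAt.of_subsingleton subsingleton_singleton,
        HasFDerivWithinAt.of_subsingleton subsingleton_singleton⟩
    | succ n ih =>
      rw [Nat.cast_succ]
      exact ih.union (by positivity) (by linarith) (hstep n)

/-- The system is invariant under `(w, v)(t) ↦ (-w, v)(-t)`, so the solution on the half-line with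
`w(0) = 0` extends by reflection. -/
theorem exists_odd_flow {p κ lam : ℝ} (hp : 1 < p) :
    ∃ w v : ℝ → ℝ, Function.Odd w ∧ Function.Even v ∧ v 0 = 1 ∧
      (∀ t, HasDerivAt w (oddPow (conjExp p) (v t)) t) ∧
      ∀ t, HasDerivAt v (κ * t * v t - lam * oddPow p (w t)) t := by
  obtain ⟨w, v, hw0, hv0, h⟩ := exists_isFlow_nonneg (κ := κ) (lam := lam) hp
  set W : ℝ → ℝ := fun t => if 0 ≤ t then w t else -w (-t) with hW
  set V : ℝ → ℝ := fun t => v |t| with hV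
  have hflow : ∀ n : ℕ, IsFlow p κ lam (-n) n W V := by
    intro n
    refine IsFlow.union (d := 0) (by simp) (by positivity) ?_ ?_
    · have := (h n).neg
      rw [neg_zero] at this
      refine this.congr (fun t ht => ?_) fun t ht => ?_
      · rcases ht.2.eq_or_lt with rfl | hlt
        · simp [hW, hw0]
        · simp [hW, not_le.2 hlt]
      · simp only [hV, abs_of_nonpos ht.2]
    · refine (h n).congr (fun t ht => ?_) fun t ht => ?_
      · simp [hW, ht.1]
      · simp only [hV, abs_of_nonneg ht.1]
  have hnhds : ∀ t : ℝ, ∃ n : ℕ, t ∈ Ioo (-n : ℝ) n := by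
    intro t
    obtain ⟨n, hn⟩ := exists_nat_gt |t|
    exact ⟨n, abs_lt.1 hn⟩
  refine ⟨W, V, fun t => ?_, fun t => by simp [hV], by simp [hV, hv0], fun t => ?_, fun t => ?_⟩
  · rcases lt_trichotomy t 0 with ht | rfl | ht
    · simp [hW, not_le.2 ht, ht.le]
    · simp [hW, hw0]
    · simp [hW, not_le.2 ht, ht.le]
  · obtain ⟨n, hn⟩ := hnhds t
    exact (hflow n t (Ioo_subset_Icc_self hn)).1.hasDerivAt (Icc_mem_nhds hn.1 hn.2)
  · obtain ⟨n, hn⟩ := hnhds t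
    exact (hflow n t (Ioo_subset_Icc_self hn)).2.hasDerivAt (Icc_mem_nhds hn.1 hn.2)

/-! ### Central solutions and the best Hardy constant -/

theorem isSolutionOn_of_flow {p κ lam : ℝ} (hp : 1 < p) {w v : ℝ → ℝ}
    (hw : ∀ t, HasDerivAt w (oddPow (conjExp p) (v t)) t)
    (hv : ∀ t, HasDerivAt v (κ * t * v t - lam * oddPow p (w t)) t) :
    IsSolutionOn p κ lam univ w := by
  have hwc : Continuous w := continuous_iff_continuousAt.2 fun t => (hw t).continuousAt
  have hvc : Continuous v := continuous_iff_continuousAt.2 fun t => (hv t).continuousAt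
  have hdw : deriv w = fun t => oddPow (conjExp p) (v t) := funext fun t => (hw t).deriv
  have hdv : deriv v = fun t => κ * t * v t - lam * oddPow p (w t) :=
    funext fun t => (hv t).deriv
  have hflux : (fun t => oddPow p (derivWithin w univ t)) = v := by
    ext t
    rw [derivWithin_univ, hdw, oddPow_oddPow_conjExp hp]
  refine ⟨?_, ?_, fun t _ => ?_⟩
  · rw [contDiffOn_univ, contDiff_one_iff_deriv, hdw]
    exact ⟨fun t => (hw t).differentiableAt, (continuous_oddPow (one_lt_conjExp hp)).comp hvc⟩
  · rw [hflux, contDiffOn_univ, contDiff_one_iff_deriv, hdv]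
    exact ⟨fun t => (hv t).differentiableAt, ((continuous_const.mul continuous_id).mul hvc).sub
      (continuous_const.mul ((continuous_oddPow hp).comp hwc))⟩
  · rw [congrFun hflux t, hflux, derivWithin_univ, hdv]
    ring

theorem solvesOn_of_flow {p κ lam : ℝ} (hp : 1 < p) {w v : ℝ → ℝ}
    (hw : ∀ t, HasDerivAt w (oddPow (conjExp p) (v t)) t)
    (hv : ∀ t, HasDerivAt v (κ * t * v t - lam * oddPow p (w t)) t) (c d : ℝ) :
    SolvesOn p κ lam c d w fun t => oddPow (conjExp p) (v t) := by
  have hwc : Continuous w := continuous_iff_continuousAt.2 fun t => (hw t).continuousAt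
  have hvc : Continuous v := continuous_iff_continuousAt.2 fun t => (hv t).continuousAt
  refine ⟨hwc.continuousOn, ((continuous_oddPow (one_lt_conjExp hp)).comp hvc).continuousOn,
    fun t _ => hw t, fun t _ => ?_⟩
  simp only [oddPow_oddPow_conjExp hp]
  exact hv t

/-- Take the odd solution with unit flux at `0`. If its flux stayed positive, `lam` would be a Hardy
constant on `(0, ∞)` and hence at most `lambdaZero`. So there is a first zero `a`, and rescaling
gives `w(a) = 1`. -/
theorem exists_isCentral {p κ lam : ℝ} (hp : 1 < p) (hκ : 0 < κ) (hlam : lambdaZero p κ < lam) :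
    ∃ a, IsCentral p κ lam a := by
  have hlam0 : 0 < lam := (lambdaZero_nonneg p κ).trans_lt hlam
  have hq := one_lt_conjExp hp
  obtain ⟨w, v, hodd, heven, hv0, hw, hv⟩ := exists_odd_flow (κ := κ) (lam := lam) hp
  have hw0 : w 0 = 0 := hodd.map_zero
  have hwc : Continuous w := continuous_iff_continuousAt.2 fun t => (hw t).continuousAt
  have hvc : Continuous v := continuous_iff_continuousAt.2 fun t => (hv t).continuousAt
  have huc : Continuous fun t => oddPow (conjExp p) (v t) := (continuous_oddPow hq).comp hvc
  have hsign : ∀ b, 0 ≤ b → (∀ t ∈ Icc 0 b, v t ≠ 0) → 0 < v b := by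
    intro b hb hne
    by_contra hn
    obtain ⟨t, ht, hvt⟩ := intermediate_value_Icc' hb hvc.continuousOn
      (show (0 : ℝ) ∈ Icc (v b) (v 0) from ⟨not_lt.1 hn, by rw [hv0]; exact zero_le_one⟩)
    exact hne t ht hvt
  have hZ : {t : ℝ | 0 ≤ t ∧ v t = 0}.Nonempty := by
    by_contra hempty
    have hpos : ∀ t, 0 ≤ t → 0 < v t := fun t ht => hsign t ht fun s hs hvs =>
      hempty ⟨s, hs.1, hvs⟩
    have hhalf : HalfIneq p κ lam (univ ∩ Ioi 0) := by
      rw [univ_inter]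
      exact halfIneq_Ioi fun a ha => (solvesOn_of_flow hp hw hv 0 a).halfIneq hp hlam0 hwc huc hw0
        (fun t ht => oddPow_pos (hpos t ht.1.le)) (oddPow_pos (hpos a ha.le)).le
    exact absurd hlam (not_lt.2 (le_csInf (rayleighValues_univ_nonempty hp hκ) fun R hR =>
      hhalf.le_of_mem_rayleighValues hp hκ hlam0 isOpen_univ ordConnected_univ (mem_univ _)
        (fun _ _ => mem_univ _) hR))
  have hclosed : IsClosed {t : ℝ | 0 ≤ t ∧ v t = 0} :=
    (isClosed_le continuous_const continuous_id).inter (isClosed_eq hvc continuous_const)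
  have hbdd : BddBelow {t : ℝ | 0 ≤ t ∧ v t = 0} := ⟨0, fun t ht => ht.1⟩
  set a := sInf {t : ℝ | 0 ≤ t ∧ v t = 0} with ha
  obtain ⟨ha0, hva⟩ : 0 ≤ a ∧ v a = 0 := hclosed.csInf_mem hZ hbdd
  have hapos : 0 < a := by
    refine ha0.lt_of_ne fun h => ?_
    rw [← h, hv0] at hva
    exact one_ne_zero hva
  have hvne : ∀ t, 0 ≤ t → t < a → v t ≠ 0 := fun t ht hta hvt =>
    absurd (csInf_le hbdd ⟨ht, hvt⟩) (not_le.2 hta)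
  have hvpos : ∀ t, 0 ≤ t → t < a → 0 < v t := fun t ht hta =>
    hsign t ht fun s hs => hvne s hs.1 (hs.2.trans_lt hta)
  have hwa : 0 < w a := by
    have h1 := (solvesOn_of_flow hp hw hv 0 a).integral_deriv ha0
    rw [hw0, sub_zero] at h1
    rw [← h1]
    exact intervalIntegral.intervalIntegral_pos_of_pos_on (huc.intervalIntegrable _ _)
      (fun x hx => oddPow_pos (hvpos x hx.1.le hx.2)) hapos
  -- The equation is homogeneous: multiplying `w` by `k` multiplies the flux by `oddPow p k`.
  set k := (w a)⁻¹ with hk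
  have hk0 : 0 < k := inv_pos.2 hwa
  have hw' : ∀ t, HasDerivAt (fun t => k * w t) (oddPow (conjExp p) (oddPow p k * v t)) t :=
    fun t => ((hw t).const_mul k).congr_deriv (by rw [oddPow_mul, oddPow_conjExp_oddPow hp])
  have hv' : ∀ t, HasDerivAt (fun t => oddPow p k * v t)
      (κ * t * (oddPow p k * v t) - lam * oddPow p (k * w t)) t :=
    fun t => ((hv t).const_mul _).congr_deriv (by rw [oddPow_mul]; ring)
  have hd : ∀ t, deriv (fun t => k * w t) t = 0 ↔ v t = 0 := by
    intro t
    rw [(hw' t).deriv, oddPow_eq_zero, mul_eq_zero, oddPow_eq_zero]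
    exact ⟨fun h => h.resolve_left hk0.ne', Or.inr⟩
  refine ⟨a, hapos, fun t => k * w t, ⟨isSolutionOn_of_flow hp hw' hv', ?_, ?_⟩, ?_, ?_, ?_⟩
  · simp only [hodd a]
    rw [mul_neg, hk, inv_mul_cancel₀ hwa.ne']
  · rw [hd, heven, hva]
  · intro t
    simp only [hodd t]
    ring
  · exact ⟨by linarith, (hd a).2 hva⟩
  · intro b hb
    by_contra hn
    have hb' : |b| < a := abs_lt.2 ⟨hb.1, not_le.1 hn⟩
    have h1 := (hd b).1 hb.2
    refine hvne |b| (abs_nonneg b) hb' ?_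
    rcases abs_choice b with h | h
    · rw [h, h1]
    · rw [h, heven, h1]

/-- This variational characterisation of `lam` by `a` replaces any comparison or uniqueness argument
for the differential equation. -/
theorem IsCentral.isGreatest_halfIneq {p κ lam a : ℝ} (hp : 1 < p) (hlam : 0 < lam)
    (h : IsCentral p κ lam a) : IsGreatest {L | HalfIneq p κ L (Ioo 0 a)} lam := by
  obtain ⟨ha, w, ⟨hsol, hwa, hda⟩, hodd, ⟨-, hda'⟩, hleast⟩ := h
  have hw0 : w 0 = 0 := hodd.map_zero
  have hC1 : ContDiff ℝ 1 w := contDiffOn_univ.1 hsol.contDiffOn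
  have hwd : ∀ t, HasDerivAt w (deriv w t) t := fun t =>
    (hC1.differentiable (by simp) t).hasDerivAt
  have huc : Continuous (deriv w) := hC1.continuous_deriv le_rfl
  have hF := contDiffOn_univ.1 hsol.contDiffOn_flux
  simp only [derivWithin_univ] at hF
  have hS : SolvesOn p κ lam 0 a w (deriv w) := by
    refine ⟨hC1.continuous.continuousOn, huc.continuousOn, fun t _ => hwd t, fun t _ => ?_⟩
    have h1 := (hF.differentiable (by simp) t).hasDerivAt
    have h2 := hsol.equation t (mem_univ t)
    simp only [derivWithin_univ] at h2
    exact h1.congr_deriv (by linarith)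
  have hne : ∀ t, -a < t → t < a → deriv w t ≠ 0 := fun t h1 h2 h3 =>
    absurd (hleast ⟨h1, h3⟩) (not_le.2 h2)
  -- Since `w` rises from `-1` to `0` on `[-a, 0]`, its derivative is positive somewhere there;
  -- having no zero in `(-a, a)`, it stays positive.
  obtain ⟨ξ, hξ, hξd⟩ : ∃ ξ ∈ Ioo (-a) 0, 0 < deriv w ξ := by
    obtain ⟨ξ, hξ, he⟩ := exists_deriv_eq_slope w (by linarith : -a < 0)
      hC1.continuous.continuousOn (hC1.differentiable (by simp)).differentiableOn
    refine ⟨ξ, hξ, ?_⟩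
    rw [he, hw0, hwa]
    simp [ha]
  have hpos : ∀ t ∈ Ioo 0 a, 0 < deriv w t := by
    intro t ht
    by_contra hn
    obtain ⟨s, hs, hs0⟩ := intermediate_value_Icc' (hξ.2.trans ht.1).le huc.continuousOn
      (show (0 : ℝ) ∈ Icc (deriv w t) (deriv w ξ) from ⟨not_lt.1 hn, hξd.le⟩)
    exact hne s (hξ.1.trans_le hs.1) (hs.2.trans_lt ht.2) hs0
  exact ⟨hS.halfIneq hp hlam hC1.continuous huc hw0 hpos hda'.ge,
    fun L hL => hS.le_of_halfIneq hp hlam ha hC1.continuous huc hw0 hpos hda' hL⟩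

theorem IsCentral.isNeumannEigenvalue {p κ lam δ : ℝ} (h : IsCentral p κ lam (δ / 2)) :
    IsNeumannEigenvalue p κ δ lam := by
  obtain ⟨ha, w, ⟨hsol, hwa, hda⟩, hodd, ⟨-, hda'⟩, hleast⟩ := h
  set a := δ / 2
  have haa : -a < a := by linarith
  have hU := uniqueDiffOn_Icc haa
  have hC1 : ContDiff ℝ 1 w := contDiffOn_univ.1 hsol.contDiffOn
  have hF := contDiffOn_univ.1 hsol.contDiffOn_flux
  simp only [derivWithin_univ] at hF
  have hd : ∀ t ∈ Icc (-a) a, derivWithin w (Icc (-a) a) t = deriv w t := fun t ht =>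
    (hC1.differentiable (by simp) t).derivWithin (hU t ht)
  have hE : EqOn (fun t => oddPow p (derivWithin w (Icc (-a) a) t)) (fun t => oddPow p (deriv w t))
      (Icc (-a) a) := fun t ht => by simp only [hd t ht]
  have hl : -a ∈ Icc (-a) a := left_mem_Icc.2 haa.le
  refine ⟨w, ⟨hC1.contDiffOn, hF.contDiffOn.congr hE, fun t ht => ?_⟩, ⟨-a, hl, by simp [hwa]⟩,
    by rw [hd _ hl, hda], by rw [hd _ (right_mem_Icc.2 haa.le), hda']⟩
  have h2 := hsol.equation t (mem_univ t)
  simp only [derivWithin_univ] at h2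
  rw [derivWithin_congr hE (hE ht), (hF.differentiable (by simp) t).derivWithin (hU t ht), hd t ht]
  exact h2

/-! ### Dependence of the best constant on the interval -/

theorem HalfIneq.of_le {p κ L a b : ℝ} (hp : 1 < p) (hκ : 0 < κ) (hL : 0 < L)
    (h : HalfIneq p κ L (Ioo 0 a)) (hb : 0 < b) (hba : b ≤ a) : HalfIneq p κ L (Ioo 0 b) := by
  rcases hba.eq_or_lt with rfl | hlt
  · exact h
  · obtain ⟨L', hL', h'⟩ := h.exists_lt hp hκ hL hb hlt
    exact h'.mono hL'.le

theorem not_lt_of_isGreatest_halfIneq {p κ L a b : ℝ} (hp : 1 < p) (hκ : 0 < κ) (hL : 0 < L)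
    (hb : 0 < b) (h₁ : IsGreatest {L | HalfIneq p κ L (Ioo 0 a)} L)
    (h₂ : IsGreatest {L | HalfIneq p κ L (Ioo 0 b)} L) : ¬ b < a := by
  intro hlt
  obtain ⟨L', hL', h'⟩ := HalfIneq.exists_lt hp hκ hL h₁.1 hb hlt
  exact absurd (h₂.2 h') (not_le.2 hL')

theorem eq_of_isGreatest_halfIneq {p κ L a b : ℝ} (hp : 1 < p) (hκ : 0 < κ) (hL : 0 < L)
    (ha : 0 < a) (hb : 0 < b) (h₁ : IsGreatest {L | HalfIneq p κ L (Ioo 0 a)} L)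
    (h₂ : IsGreatest {L | HalfIneq p κ L (Ioo 0 b)} L) : a = b :=
  le_antisymm (not_lt.1 (not_lt_of_isGreatest_halfIneq hp hκ hL hb h₁ h₂))
    (not_lt.1 (not_lt_of_isGreatest_halfIneq hp hκ hL ha h₂ h₁))

/-- For each `g` the condition is a closed upper bound on `ENNReal.ofReal L`, or is void. Together
with boundedness and nonemptiness this makes the best constant attained. -/
theorem isClosed_setOf_halfIneq (p κ : ℝ) (J : Set ℝ) : IsClosed {L | HalfIneq p κ L J} := by
  have : {L | HalfIneq p κ L J} = ⋂ (g : ℝ → ENNReal) (_ : Measurable g),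
      {L | ENNReal.ofReal L * ∫⁻ t in J, (∫⁻ s in Ioo 0 t, g s) ^ p * ENNReal.ofReal (rho κ t)
        ≤ ∫⁻ t in J, g t ^ p * ENNReal.ofReal (rho κ t)} := by
    ext L; simp [HalfIneq]
  rw [this]
  refine isClosed_iInter fun g => isClosed_iInter fun _ => ?_
  set X := ∫⁻ t in J, (∫⁻ s in Ioo 0 t, g s) ^ p * ENNReal.ofReal (rho κ t)
  set Y := ∫⁻ t in J, g t ^ p * ENNReal.ofReal (rho κ t)
  by_cases hX : X = 0
  · simp [hX]
  by_cases hY : Y = ⊤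
  · simp [hY]
  simp only [← ENNReal.le_div_iff_mul_le (Or.inl hX) (Or.inr hY)]
  exact isClosed_le ENNReal.continuous_ofReal continuous_const

theorem bddAbove_setOf_halfIneq {p κ a : ℝ} (hp : 1 < p) (hκ : 0 < κ) (ha : 0 < a) :
    BddAbove {L | HalfIneq p κ L (Ioo 0 a)} := by
  have hp0 : 0 < p := by linarith
  set X := ∫⁻ t in Ioo 0 a, (∫⁻ _ in Ioo 0 t, (1 : ENNReal)) ^ p * ENNReal.ofReal (rho κ t) with hX
  have hX0 : X ≠ 0 := by
    intro h
    have hm : Measurable fun t : ℝ =>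
        (∫⁻ _ in Ioo 0 t, (1 : ENNReal)) ^ p * ENNReal.ofReal (rho κ t) := by
      simp only [setLIntegral_const, Real.volume_Ioo, one_mul]
      exact ((measurable_id.sub_const 0).ennreal_ofReal.pow_const p).mul (measurable_ofReal_rho κ)
    rw [hX, setLIntegral_eq_zero_iff measurableSet_Ioo hm] at h
    have h2 : ∀ᵐ t : ℝ, t ∈ Ioo 0 a → False := by
      filter_upwards [h] with t ht htm
      have h3 := ht htm
      simp only [setLIntegral_const, Real.volume_Ioo, one_mul, mul_eq_zero,
        ENNReal.rpow_eq_zero_iff_of_pos hp0, ENNReal.ofReal_eq_zero] at h3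
      rcases h3 with h3 | h3
      · linarith [htm.1]
      · linarith [rho_pos κ t]
    have h4 := ae_iff.1 h2
    have h5 : {t : ℝ | ¬(t ∈ Ioo 0 a → False)} = Ioo 0 a := by ext; simp
    rw [h5, Real.volume_Ioo] at h4
    simp at h4
    linarith
  have hY : ∫⁻ t in Ioo 0 a, (1 : ENNReal) ^ p * ENNReal.ofReal (rho κ t) ≠ ⊤ := by
    simp only [ENNReal.one_rpow, one_mul]
    exact lintegral_rho_ne_top hκ _
  set Y := ∫⁻ t in Ioo 0 a, (1 : ENNReal) ^ p * ENNReal.ofReal (rho κ t)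
  refine ⟨(Y / X).toReal, fun L hL => ?_⟩
  have h1 : ENNReal.ofReal L * X ≤ Y := hL (fun _ => 1) measurable_const
  rw [← ENNReal.le_div_iff_mul_le (Or.inl hX0) (Or.inr hY)] at h1
  exact (ENNReal.ofReal_le_iff_le_toReal (ENNReal.div_ne_top hY hX0)).1 h1

/-- Let `μ` be the best constant on `(0, a)`. As `μ > lambdaZero`, it has a central solution on some
`(-b, b)`, so `μ` is also best on `(0, b)`, and strict monotonicity forces `b = a`. -/
theorem exists_isCentral_of_pos {p κ a : ℝ} (hp : 1 < p) (hκ : 0 < κ) (ha : 0 < a) :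
    ∃ lam, lambdaZero p κ < lam ∧ IsCentral p κ lam a := by
  -- If `lambdaZero > 0`, it is admissible on the longer interval `(0, a + 1)` and improves strictly
  -- on `(0, a)`; if it is `0`, any positive constant will do.
  obtain ⟨L, hL, hLi⟩ : ∃ L, lambdaZero p κ < L ∧ HalfIneq p κ L (Ioo 0 a) := by
    rcases (lambdaZero_nonneg p κ).eq_or_lt with h | h
    · rw [← h]; exact exists_halfIneq hp hκ ha
    · exact (halfIneq_lambdaZero (b := a + 1) hp hκ).exists_lt hp hκ h ha (by linarith)
  have hbdd := bddAbove_setOf_halfIneq hp hκ ha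
  have hgr : IsGreatest {L | HalfIneq p κ L (Ioo 0 a)} (sSup {L | HalfIneq p κ L (Ioo 0 a)}) :=
    ⟨(isClosed_setOf_halfIneq p κ _).csSup_mem ⟨L, hLi⟩ hbdd, fun _ h => le_csSup hbdd h⟩
  set μ := sSup {L | HalfIneq p κ L (Ioo 0 a)}
  have hμ : lambdaZero p κ < μ := hL.trans_le (hgr.2 hLi)
  have hμ0 : 0 < μ := (lambdaZero_nonneg p κ).trans_lt hμ
  obtain ⟨b, hb⟩ := exists_isCentral hp hκ hμ
  rw [eq_of_isGreatest_halfIneq hp hκ hμ0 ha hb.1 hgr (hb.isGreatest_halfIneq hp hμ0)]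
  exact ⟨μ, hμ, hb⟩

theorem existsUnique_isCentral {p κ lam : ℝ} (hp : 1 < p) (hκ : 0 < κ)
    (hlam : lambdaZero p κ < lam) : ∃! a, IsCentral p κ lam a := by
  have hlam0 : 0 < lam := (lambdaZero_nonneg p κ).trans_lt hlam
  obtain ⟨a, ha⟩ := exists_isCentral hp hκ hlam
  exact ⟨a, ha, fun b hb => eq_of_isGreatest_halfIneq hp hκ hlam0 hb.1 ha.1
    (hb.isGreatest_halfIneq hp hlam0) (ha.isGreatest_halfIneq hp hlam0)⟩

theorem IsCentral.aBar_eq {p κ lam a : ℝ} (hp : 1 < p) (hκ : 0 < κ)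
    (hlam : lambdaZero p κ < lam) (h : IsCentral p κ lam a) : aBar p κ lam = a := by
  have : {a : ℝ | IsCentral p κ lam a} = {a} := by
    ext b
    exact ⟨fun hb => (existsUnique_isCentral hp hκ hlam).unique hb h, fun hb => by
      rw [mem_singleton_iff.1 hb]; exact h⟩
  rw [aBar, this, csInf_singleton]

theorem isCentral_aBar {p κ lam : ℝ} (hp : 1 < p) (hκ : 0 < κ)
    (hlam : lambdaZero p κ < lam) : IsCentral p κ lam (aBar p κ lam) := by
  obtain ⟨a, ha⟩ := exists_isCentral hp hκ hlam
  rwa [ha.aBar_eq hp hκ hlam]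

/-! ### The length function and its inverse -/

theorem strictAntiOn_deltaBar {p κ : ℝ} (hp : 1 < p) (hκ : 0 < κ) :
    StrictAntiOn (deltaBar p κ) (Ioi (lambdaZero p κ)) := by
  intro x hx y hy hxy
  have hx0 : 0 < x := (lambdaZero_nonneg p κ).trans_lt hx
  have hy0 : 0 < y := hx0.trans hxy
  have hcx := isCentral_aBar hp hκ hx
  have hcy := isCentral_aBar hp hκ hy
  by_contra hn
  have hle : aBar p κ x ≤ aBar p κ y := by
    simp only [deltaBar, not_lt] at hn; linarith
  exact absurd ((hcx.isGreatest_halfIneq hp hx0).2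
    (HalfIneq.of_le hp hκ hy0 (hcy.isGreatest_halfIneq hp hy0).1 hcx.1 hle)) (not_le.2 hxy)

theorem bijOn_deltaBar {p κ : ℝ} (hp : 1 < p) (hκ : 0 < κ) :
    BijOn (deltaBar p κ) (Ioi (lambdaZero p κ)) (Ioi 0) := by
  refine ⟨fun x hx => ?_, (strictAntiOn_deltaBar hp hκ).injOn, fun δ hδ => ?_⟩
  · have := (isCentral_aBar hp hκ hx).1
    rw [mem_Ioi, deltaBar]; positivity
  · obtain ⟨lam, hlam, h⟩ := exists_isCentral_of_pos hp hκ (half_pos (mem_Ioi.1 hδ))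
    refine ⟨lam, hlam, ?_⟩
    rw [deltaBar, h.aBar_eq hp hκ hlam]; ring

theorem strictAntiOn_lambdaOf {p κ : ℝ} (hp : 1 < p) (hκ : 0 < κ) :
    StrictAntiOn (lambdaOf p κ) (Ioi 0) := by
  intro x hx y hy hxy
  have hb := bijOn_deltaBar hp hκ
  have hinv := hb.surjOn.rightInvOn_invFunOn
  have hm := hb.surjOn.mapsTo_invFunOn
  by_contra hn
  have := (strictAntiOn_deltaBar hp hκ).antitoneOn (hm hx) (hm hy) (not_lt.1 hn)
  rw [hinv hx, hinv hy] at this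
  exact absurd hxy (not_lt.2 this)

theorem continuousOn_lambdaOf {p κ : ℝ} (hp : 1 < p) (hκ : 0 < κ) :
    ContinuousOn (lambdaOf p κ) (Ioi 0) := by
  have hb := bijOn_deltaBar hp hκ
  have hm := hb.surjOn.mapsTo_invFunOn
  intro δ hδ
  have hmono : StrictMonoOn (fun x => -lambdaOf p κ x) (Ioi 0) := fun x hx y hy hxy =>
    neg_lt_neg (strictAntiOn_lambdaOf hp hκ hx hy hxy)
  have hc : ContinuousAt (fun x => -lambdaOf p κ x) δ := by
    refine hmono.continuousAt_of_image_mem_nhds (Ioi_mem_nhds hδ) ?_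
    -- A strictly monotone function whose image contains a neighbourhood of a value is continuous
    -- there; the image of `-lambdaOf` contains all of `Iio (-lambdaZero p κ)`.
    refine Filter.mem_of_superset (Iio_mem_nhds (neg_lt_neg (mem_Ioi.1 (hm hδ)))) fun y hy => ?_
    have hy' : -y ∈ Ioi (lambdaZero p κ) := by rw [mem_Ioi]; linarith [mem_Iio.1 hy]
    refine ⟨deltaBar p κ (-y), hb.mapsTo hy', ?_⟩
    have : lambdaOf p κ (deltaBar p κ (-y)) = -y := hb.injOn.leftInvOn_invFunOn hy'
    simp only [this, neg_neg]
  exact hc.neg.continuousWithinAt.congr (fun x _ => by simp) (by simp)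

end PModel

theorem mainTheorem7 (p κ : ℝ) (hp : 1 < p) (hκ : 0 < κ) :
    (∀ lam : ℝ, PModel.lambdaZero p κ < lam → ∃! a : ℝ, PModel.IsCentral p κ lam a) ∧
    StrictAntiOn (PModel.deltaBar p κ) (Ioi (PModel.lambdaZero p κ)) ∧
    BijOn (PModel.deltaBar p κ) (Ioi (PModel.lambdaZero p κ)) (Ioi 0) ∧
    StrictAntiOn (PModel.lambdaOf p κ) (Ioi 0) ∧
    ContinuousOn (PModel.lambdaOf p κ) (Ioi 0) ∧
    ∀ δ : ℝ, 0 < δ →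
      IsLeast {μ : ℝ | μ ≠ 0 ∧ PModel.IsNeumannEigenvalue p κ δ μ} (PModel.lambdaOf p κ δ) ∧
      IsLeast (PModel.rayleighValues p κ (Ioo (-(δ / 2)) (δ / 2))) (PModel.lambdaOf p κ δ) := by
  refine ⟨fun lam hlam => PModel.existsUnique_isCentral hp hκ hlam,
    PModel.strictAntiOn_deltaBar hp hκ, PModel.bijOn_deltaBar hp hκ,
    PModel.strictAntiOn_lambdaOf hp hκ, PModel.continuousOn_lambdaOf hp hκ, fun δ hδ => ?_⟩
  have hb := PModel.bijOn_deltaBar hp hκ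
  have hlam : PModel.lambdaZero p κ < PModel.lambdaOf p κ δ := hb.surjOn.mapsTo_invFunOn hδ
  have hdel : PModel.deltaBar p κ (PModel.lambdaOf p κ δ) = δ := hb.surjOn.rightInvOn_invFunOn hδ
  set lam := PModel.lambdaOf p κ δ
  have hlam0 : 0 < lam := (PModel.lambdaZero_nonneg p κ).trans_lt hlam
  have hc : PModel.IsCentral p κ lam (δ / 2) := by
    have h := PModel.isCentral_aBar hp hκ hlam
    have e : PModel.aBar p κ lam = δ / 2 := by rw [PModel.deltaBar] at hdel; linarith
    rwa [e] at h
  have hN := hc.isNeumannEigenvalue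
  have hlow : ∀ R ∈ PModel.rayleighValues p κ (Ioo (-(δ / 2)) (δ / 2)), lam ≤ R := fun R hR => by
    refine PModel.HalfIneq.le_of_mem_rayleighValues hp hκ hlam0 isOpen_Ioo ordConnected_Ioo
      ⟨by linarith, by linarith⟩ (fun x hx => ⟨by linarith [hx.2], by linarith [hx.1]⟩) ?_ hR
    rw [Ioo_inter_Ioi, max_eq_right (by linarith)]
    exact (hc.isGreatest_halfIneq hp hlam0).1
  -- The bound `hlow` serves both minima, since nonzero eigenvalues are Rayleigh values, and the
  -- central solution attains both.
  exact ⟨⟨⟨hlam0.ne', hN⟩, fun μ hμ => hlow μ (hμ.2.mem_rayleighValues hp hκ hδ hμ.1)⟩,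
    hN.mem_rayleighValues hp hκ hδ hlam0.ne', hlow⟩
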